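/- Let $\Bbbk$ be an algebraically closed field of characteristic $0$, $H$ a finite-dimensional Hopf algebra over $\Bbbk$ with antipode $\mathcal S$, counit $\varepsilon$ and group of group-like elements $G(H)$, $A\subseteq G(H)$ a finite abelian subgroup with normalizer $N(A)$ in $G(H)$, and $\widehat A$ its group of characters. For $\mu\in\widehat A$ let $P_\mu=\frac1{|A|}\sum_{a\in A}\mu(a^{-1})a$, let $X[\mu]=\{x\in X: a x=\mu(a)x\ \forall a\in A\}$ for an $H$-module $X$, and let $C(\mu)=\{\alpha\in H^*:\alpha(ah)=\mu(a)\alpha(h)\ \forall a\in A, h\in H\}$ with $H$-action $(h\cdot\alpha)(t)=\alpha(th)$. Definitions. For a finite-dimensional left $H$-comodule algebra $K$ and left $K$-modules $V,W$, the Yan--Zhu stabilizer $\mathrm{St}_K(V,W)$ is the intersection of $\mathrm{Hom}_K(H^*\otimes V,H^*\otimes W)$ with the image of $\mathcal L:H^*\otimes\mathrm{Hom}(V,W)\to\mathrm{Hom}(H^*\otimes V,H^*\otimes W)$, $\mathcal L(\gamma\otimes T)(\xi\otimes v)=\gamma\xi\otimes T(v)$, where $K$ acts on $H^*\otimes V$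 by $k\cdot(\gamma\otimes v)=\gamma(\mathcal S^{-1}(k_{(-1)})\,\cdot\,)\otimes k_{(0)}v$; it is an $H$-module by $h\cdot\mathcal L(\gamma\otimes T)=\mathcal L(\gamma(\,\cdot\, h)\otimes T)$. A dynamical datum for $(H,A)$ is a pair $(K,\{V_\lambda\}_{\lambda\in\widehat A})$ of a finite-dimensional left $H$-comodule algebra $K$ that is $H$-simple, semisimple as an algebra and has $K^{\mathrm{co}H}=\Bbbk$, and irreducible $K$-modules $V_\lambda$ with $H$-module isomorphisms $\mathrm{St}_K(V_\lambda,V_\mu)\simeq C(\lambda\mu^{-1})$ for all $\lambda,\mu\in\widehat A$. A dynamical twist is a map $J:\widehat A\to H\otimes H$ with invertible values such that, for all $\lambda\in\widehat A$ and $a\in A$, $J(\lambda)(a\otimes a)=(a\otimes a)J(\lambda)$, $\sum_\mu(\Delta\otimes\mathrm{id})J(\lambda)\,(J(\lambda\mu^{-1})\otimes P_\mu)=(\mathrm{id}\otimes\Delta)J(\lambda)\,(1\otimes J(\lambda))$ and $(\varepsilon\otimes\mathrm{id})J(\lambda)=(\mathrm{id}\otimes\varepsilon)J(\lambda)=1$.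 Given a dynamical datum and $H$-module isomorphisms $\omega_{\lambda,\mu}:\mathrm{St}_K(V_\lambda,V_\mu)\to C(\lambda\mu^{-1})$ with $\omega_{\lambda,\lambda}(\mathrm{id})=\varepsilon$, define, for a finite-dimensional $H$-module $X$ and $x\in X[\mu]$, the map $\Psi(\lambda,x):X^*\otimes V_\lambda\to V_{\lambda\mu}$, $\Psi(\lambda,x)(\varphi\otimes v)=(\mathrm{ev}_{1}\otimes\mathrm{id})\big(\omega_{\lambda,\lambda\mu}^{-1}(h\mapsto\varphi(\mathcal S(h)x))(\varepsilon\otimes v)\big)$. The associated dynamical twist is $J(\lambda)=(\mathcal S^{-1}\otimes\mathcal S^{-1})\tau(I(\lambda)^{-1})$, $\tau$ the flip, where $I(\lambda)\in H\otimes H$ is the invertible element such that for all finite-dimensional $H$-modules $X,Y$ and all $x\in X[\mu]$, $y\in Y[\eta]$ one has $I(\lambda)(x\otimes y)\in(X\otimes Y)[\mu\eta]$ and $\Psi(\lambda,I(\lambda)(x\otimes y))=\Psi(\lambda\mu,y)\,(\mathrm{id}_{Y^*}\otimes\Psi(\lambda,x))$ under $(X\otimes Y)^*\simeq Y^*\otimes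 X^*$. Statement. Let $f:\widehat A\to\widehat A$ be a bijection and, for all $\lambda,\mu\in\widehat A$, let $g(\lambda,\mu)\in N(A)$ be such that $$\big(f(\lambda)f(\mu)^{-1}\big)(a)=(\mu\lambda^{-1})\big(g(\lambda,\mu)\,a\,g(\lambda,\mu)^{-1}\big)\qquad\text{for all }a\in A.$$ Regard the group algebra $K=\Bbbk[A]$ as a left $H$-comodule algebra by $a\mapsto a\otimes a$, and let $V_\lambda=\Bbbk_{f(\lambda)}$ be the one-dimensional module afforded by $f(\lambda)$. Then $(\Bbbk[A],\{\Bbbk_{f(\lambda)}\})$ is a dynamical datum for $(H,A)$. Moreover $$J(\lambda)=\sum_{\mu,\eta\in\widehat A} g(\lambda,\lambda\mu^{-1}\eta^{-1})\,g(\lambda\eta^{-1},\lambda\mu^{-1}\eta^{-1})^{-1}P_\mu\otimes g(\lambda,\lambda\mu^{-1}\eta^{-1})\,g(\lambda,\lambda\eta^{-1})^{-1}P_\eta$$ is a dynamical twist, and for a suitable choice of the isomorphisms $\omega_{\lambda,\mu}$ the maps $\Psi$ are $\Psi(\lambda,x)(\varphi\otimes1)=\varphi(g(\lambda,\lambda\mu)^{-1}x)$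 for $x\in X[\mu]$, and the dynamical twist associated to the datum is $J$. -/

import Mathlib

open scoped TensorProduct
open Module

universe w

noncomputable section

namespace DynTwist

section Representations

variable {k H K X Y V : Type*} [Field k] [Ring H] [HopfAlgebra k H] [Ring K] [Algebra k K]
  [AddCommGroup X] [Module k X] [AddCommGroup Y] [Module k Y] [AddCommGroup V] [Module k V]

/-!
Modules over a `k`-algebra `R` are given as `k`-vector spaces `X` with a representation
`R →ₐ[k] Module.End k X`.
-/

/-- An isomorphism of modules over the algebra `R`. -/
structure ModIso {k R X Y : Type*} [Field k] [Ring R] [Algebra k R]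
    [AddCommMonoid X] [Module k X] [AddCommMonoid Y] [Module k Y]
    (ρ : R →ₐ[k] Module.End k X) (σ : R →ₐ[k] Module.End k Y) extends X ≃ₗ[k] Y where
  map_act : ∀ (r : R) (x : X), toFun (ρ r x) = σ r (toFun x)

/-- Irreducible module: nonzero, without submodules other than `0` and itself. -/
def IsIrreducibleMod {R : Type*} [Ring R] [Algebra k R] (ρ : R →ₐ[k] Module.End k X) : Prop :=
  Nontrivial X ∧ ∀ p : Submodule k X, (∀ r, ∀ x ∈ p, ρ r x ∈ p) → p = ⊥ ∨ p = ⊤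

/-- The action of `H ⊗ H` on `X ⊗ Y`. -/
def outerRep (ρX : H →ₐ[k] Module.End k X) (ρY : H →ₐ[k] Module.End k Y) :
    H ⊗[k] H →ₐ[k] Module.End k (X ⊗[k] Y) :=
  (Module.endTensorEndAlgHom (R := k) (S := k) (A := k) (M := X) (N := Y)).comp
    (Algebra.TensorProduct.map ρX ρY)

/-- The tensor product of two `H`-modules, with `H` acting through the comultiplication. -/
def tensorRep (ρX : H →ₐ[k] Module.End k X) (ρY : H →ₐ[k] Module.End k Y) :
    H →ₐ[k] Module.End k (X ⊗[k] Y) :=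
  (outerRep ρX ρY).comp (Bialgebra.comulAlgHom k H)

variable (k H) in
/-- The composition inverse `S⁻¹` of the antipode, which is bijective because `H` is
finite-dimensional in all that follows. -/
def antipodeInv : H →ₗ[k] H :=
  Ring.inverse (HopfAlgebra.antipode k (A := H) : Module.End k H)

end Representations

section ComoduleAlgebras

/-- A left `H`-comodule algebra structure on the algebra `K`: a coassociative and counital
coaction `δ : K → H ⊗ K` that is a morphism of algebras. -/
structure LeftComoduleAlgebra (k H K : Type*) [Field k] [Ring H] [HopfAlgebra k H]
    [Ring K] [Algebra k K] where
  coact : K →ₐ[k] H ⊗[k] K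
  coassoc : ∀ x : K,
    TensorProduct.assoc k H H K
        (LinearMap.rTensor K (Coalgebra.comul (R := k) (A := H)) (coact x)) =
      LinearMap.lTensor H coact.toLinearMap (coact x)
  counit_coact : ∀ x : K,
    TensorProduct.lid k K
      (LinearMap.rTensor K (Coalgebra.counit (R := k) (A := H)) (coact x)) = x

variable {k H K : Type*} [Field k] [Ring H] [HopfAlgebra k H] [Ring K] [Algebra k K]

/-- A two-sided ideal `I` is costable if `δ(I) ⊆ H ⊗ I`. -/
def LeftComoduleAlgebra.IsCostable (D : LeftComoduleAlgebra k H K) (I : TwoSidedIdeal K) : Prop :=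
  ∀ x ∈ I, D.coact x ∈
    LinearMap.range (LinearMap.lTensor H (I.asIdeal.restrictScalars k).subtype)

/-- `K` is `H`-simple: it is nonzero and has no nontrivial costable two-sided ideals. -/
def LeftComoduleAlgebra.IsHSimple (D : LeftComoduleAlgebra k H K) : Prop :=
  Nontrivial K ∧ ∀ I : TwoSidedIdeal K, D.IsCostable I → I = ⊥ ∨ I = ⊤

/-- The coinvariants of `K` are the scalars. -/
def LeftComoduleAlgebra.HasTrivialCoinvariants (D : LeftComoduleAlgebra k H K) : Prop :=
  ∀ x : K, D.coact x = 1 ⊗ₜ[k] x ↔ ∃ c : k, x = algebraMap k K c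

end ComoduleAlgebras

section Stabilizers

variable {k H K V W : Type*} [Field k] [Ring H] [HopfAlgebra k H] [Ring K] [Algebra k K]
  [AddCommGroup V] [Module k V] [AddCommGroup W] [Module k W]

/-- The action of `H` on `H^*` used for the `K`-action: `(h · γ)(t) = γ(S⁻¹(h) t)`. -/
def dualLeft : H →ₗ[k] Dual k H →ₗ[k] Dual k H :=
  LinearMap.mk₂ k (fun h γ => γ ∘ₗ LinearMap.mulLeft k (antipodeInv k H h))
    (fun _ _ _ => by ext; simp [add_mul]) (fun _ _ _ => by ext; simp)
    (fun _ _ _ => by ext; simp) (fun _ _ _ => by ext; simp)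

/-- The action of `H` on `H^*` by right translations: `(h · γ)(t) = γ(t h)`. -/
def dualRight : H →ₐ[k] Module.End k (Dual k H) :=
  AlgHom.ofLinearMap
    (LinearMap.mk₂ k (fun h γ => γ ∘ₗ LinearMap.mulRight k h)
      (fun _ _ _ => by ext; simp [mul_add]) (fun _ _ _ => by ext; simp)
      (fun _ _ _ => by ext; simp) (fun _ _ _ => by ext; simp))
    (by ext; simp) (fun _ _ => by ext; simp [mul_assoc])

@[simp] lemma dualRight_apply (h t : H) (γ : Dual k H) : dualRight h γ t = γ (t * h) := rfl

lemma dualLeft_dualRight (a b : H) (γ : Dual k H) :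
    dualRight a (dualLeft b γ) = dualLeft b (dualRight a γ) := by
  ext t
  simp [dualLeft, mul_assoc]

/-- The product of `H^*`, i.e. convolution. -/
def dualMul : Dual k H →ₗ[k] Dual k H →ₗ[k] Dual k H :=
  LinearMap.mk₂ k (fun γ ξ => (WithConv.toConv γ * WithConv.toConv ξ).ofConv)
    (fun _ _ _ => by simp [add_mul]) (fun _ _ _ => by rw [WithConv.toConv_smul, smul_mul_assoc]; rfl)
    (fun _ _ _ => by simp [mul_add]) (fun _ _ _ => by rw [WithConv.toConv_smul, mul_smul_comm]; rfl)

lemma dualMul_apply (γ ξ : Dual k H) (t : H) :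
    dualMul γ ξ t = LinearMap.mul' k k (TensorProduct.map γ ξ (Coalgebra.comul t)) := rfl

/-- The `K`-action on `H^* ⊗ V`: `x · (γ ⊗ v) = x₍₋₁₎ · γ ⊗ x₍₀₎ v`. -/
def stabAct (D : LeftComoduleAlgebra k H K) (ρ : K →ₐ[k] Module.End k V) :
    K →ₗ[k] Module.End k (Dual k H ⊗[k] V) :=
  TensorProduct.homTensorHomMap (RingHom.id k) (Dual k H) V (Dual k H) V ∘ₗ
    TensorProduct.map dualLeft ρ.toLinearMap ∘ₗ D.coact.toLinearMap

variable (k H V W) in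
/-- The map `𝓛 : H^* ⊗ Hom(V, W) → Hom(H^* ⊗ V, H^* ⊗ W)`,
`𝓛(γ ⊗ T)(ξ ⊗ v) = γ ξ ⊗ T v`. -/
def leftMulMap :
    Dual k H ⊗[k] (V →ₗ[k] W) →ₗ[k] (Dual k H ⊗[k] V →ₗ[k] Dual k H ⊗[k] W) :=
  TensorProduct.homTensorHomMap (RingHom.id k) (Dual k H) V (Dual k H) W ∘ₗ
    TensorProduct.map dualMul LinearMap.id

lemma leftMulMap_tmul (γ ξ : Dual k H) (T : V →ₗ[k] W) (v : V) :
    leftMulMap k H V W (γ ⊗ₜ T) (ξ ⊗ₜ v) = dualMul γ ξ ⊗ₜ T v := rfl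

/-- The Yan–Zhu stabilizer `St_K(V, W)`. -/
def stabilizer (D : LeftComoduleAlgebra k H K)
    (ρ : K →ₐ[k] Module.End k V) (σ : K →ₐ[k] Module.End k W) :
    Submodule k (Dual k H ⊗[k] V →ₗ[k] Dual k H ⊗[k] W) where
  carrier := {φ | (∀ x : K, φ ∘ₗ stabAct D ρ x = stabAct D σ x ∘ₗ φ) ∧
    φ ∈ LinearMap.range (leftMulMap k H V W)}
  zero_mem' := ⟨fun _ => by simp, zero_mem _⟩
  add_mem' ha hb := ⟨fun x => by rw [LinearMap.add_comp, LinearMap.comp_add, ha.1, hb.1],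
    add_mem ha.2 hb.2⟩
  smul_mem' c _ ha := ⟨fun x => by rw [LinearMap.smul_comp, LinearMap.comp_smul, ha.1],
    Submodule.smul_mem _ c ha.2⟩


variable (k H V W) in
/-- The action of `H` on `Hom(H^* ⊗ V, H^* ⊗ W)` through right translations on the target. -/
def postRep : H →ₐ[k] Module.End k (Dual k H ⊗[k] V →ₗ[k] Dual k H ⊗[k] W) :=
  AlgHom.ofLinearMap
    (LinearMap.mk₂ k (fun a φ => LinearMap.rTensor W (dualRight (k := k) a) ∘ₗ φ)
      (fun _ _ _ => by simp [LinearMap.rTensor_add, LinearMap.add_comp])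
      (fun _ _ _ => by simp [LinearMap.rTensor_smul, LinearMap.smul_comp])
      (fun _ _ _ => by simp [LinearMap.comp_add])
      (fun _ _ _ => by simp [LinearMap.comp_smul]))
    (by ext1 φ; simp [Module.End.one_eq_id])
    (fun a b => by
      ext1 φ
      simp [Module.End.mul_eq_comp, LinearMap.rTensor_comp, LinearMap.comp_assoc])

variable (k H V W) in
/-- The action of `H` on `Hom(H^* ⊗ V, H^* ⊗ W)` through the antipode and right translations on
the source. -/
def preRep : H →ₐ[k] Module.End k (Dual k H ⊗[k] V →ₗ[k] Dual k H ⊗[k] W) :=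
  AlgHom.ofLinearMap
    (LinearMap.mk₂ k
      (fun b φ => φ ∘ₗ LinearMap.rTensor V (dualRight (k := k) (HopfAlgebra.antipode k b)))
      (fun _ _ _ => by simp [LinearMap.rTensor_add, LinearMap.comp_add])
      (fun _ _ _ => by simp [LinearMap.rTensor_smul, LinearMap.comp_smul])
      (fun _ _ _ => by simp [LinearMap.add_comp])
      (fun _ _ _ => by simp [LinearMap.smul_comp]))
    (by ext1 φ; simp [Module.End.one_eq_id, HopfAlgebra.antipode_one])
    (fun a b => by
      ext1 φ
      simp [Module.End.mul_eq_comp, LinearMap.rTensor_comp, LinearMap.comp_assoc,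
        HopfAlgebra.antipode_mul_antidistrib])

lemma postRep_apply (a : H) (φ : Dual k H ⊗[k] V →ₗ[k] Dual k H ⊗[k] W) :
    postRep k H V W a φ = LinearMap.rTensor W (dualRight a) ∘ₗ φ := rfl

lemma preRep_apply (b : H) (φ : Dual k H ⊗[k] V →ₗ[k] Dual k H ⊗[k] W) :
    preRep k H V W b φ =
      φ ∘ₗ LinearMap.rTensor V (dualRight (HopfAlgebra.antipode k b)) := rfl

lemma commute_postRep_preRep (a b : H) : Commute (postRep k H V W a) (preRep k H V W b) := by
  rw [commute_iff_eq]
  refine LinearMap.ext fun φ => ?_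
  simp only [Module.End.mul_apply, postRep_apply, preRep_apply, LinearMap.comp_assoc]

variable (k H V W) in
/-- The two commuting actions of `H` on `Hom(H^* ⊗ V, H^* ⊗ W)`, combined. -/
def conjAux : H ⊗[k] H →ₐ[k] Module.End k (Dual k H ⊗[k] V →ₗ[k] Dual k H ⊗[k] W) :=
  Algebra.TensorProduct.lift (postRep k H V W) (preRep k H V W) commute_postRep_preRep

variable (k H V W) in
/-- The action of `H` on `Hom(H^* ⊗ V, H^* ⊗ W)`: `h · φ = h₍₁₎ ∘ φ ∘ S(h₍₂₎)`, where `H` acts on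
`H^*` by right translations. -/
def homRep : H →ₐ[k] Module.End k (Dual k H ⊗[k] V →ₗ[k] Dual k H ⊗[k] W) :=
  (conjAux k H V W).comp (Bialgebra.comulAlgHom k H)

lemma conjAux_tmul (a b : H) (φ : Dual k H ⊗[k] V →ₗ[k] Dual k H ⊗[k] W) :
    conjAux k H V W (a ⊗ₜ b) φ = LinearMap.rTensor W (dualRight a) ∘ₗ φ ∘ₗ
      LinearMap.rTensor V (dualRight (HopfAlgebra.antipode k b)) := by
  rw [conjAux, Algebra.TensorProduct.lift_tmul, Module.End.mul_apply, preRep_apply, postRep_apply]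

lemma conj_dualMul (h : H) (γ ξ : Dual k H) :
    TensorProduct.lift (LinearMap.mk₂ k
      (fun a b => dualRight a (dualMul γ (dualRight (HopfAlgebra.antipode k b) ξ)))
      (fun _ _ _ => by simp) (fun _ _ _ => by simp) (fun _ _ _ => by simp)
      (fun _ _ _ => by simp)) (Coalgebra.comul h) = dualMul (dualRight h γ) ξ := by
  have key : ∀ (p q : H) (z : H ⊗[k] (H ⊗[k] H)),
      z = LinearMap.lTensor H Coalgebra.comul (Coalgebra.comul h) →
      TensorProduct.lift (LinearMap.mul k k) (TensorProduct.map (γ ∘ₗ LinearMap.mulLeft k p)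
        (ξ ∘ₗ LinearMap.mulLeft k q ∘ₗ LinearMap.mul' k H ∘ₗ
          LinearMap.lTensor H (HopfAlgebra.antipode k)) z) = γ (p * h) * ξ q := by
    rintro p q z rfl
    have e : (LinearMap.mul' k H ∘ₗ LinearMap.lTensor H (HopfAlgebra.antipode k)) ∘ₗ
        Coalgebra.comul = Algebra.linearMap k H ∘ₗ Coalgebra.counit :=
      HopfAlgebra.mul_antipode_lTensor_comul
    have e2 : TensorProduct.map (γ ∘ₗ LinearMap.mulLeft k p)
        (ξ ∘ₗ LinearMap.mulLeft k q ∘ₗ LinearMap.mul' k H ∘ₗ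
          LinearMap.lTensor H (HopfAlgebra.antipode k)) ∘ₗ LinearMap.lTensor H Coalgebra.comul =
        TensorProduct.map (γ ∘ₗ LinearMap.mulLeft k p)
          (ξ ∘ₗ LinearMap.mulLeft k q ∘ₗ Algebra.linearMap k H) ∘ₗ
          LinearMap.lTensor H Coalgebra.counit := by
      rw [LinearMap.map_comp_lTensor, LinearMap.map_comp_lTensor, LinearMap.comp_assoc,
        LinearMap.comp_assoc, LinearMap.comp_assoc, ← LinearMap.comp_assoc Coalgebra.comul, e,
        LinearMap.comp_assoc, LinearMap.comp_assoc]
    have e3 := LinearMap.congr_fun e2 (Coalgebra.comul h)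
    rw [LinearMap.comp_apply, LinearMap.comp_apply, Coalgebra.lTensor_counit_comul] at e3
    rw [e3]
    simp
  ext t
  have gen : ∀ w : H ⊗[k] H, TensorProduct.lift (LinearMap.mk₂ k
      (fun a b => dualRight a (dualMul γ (dualRight (HopfAlgebra.antipode k b) ξ)))
      (fun _ _ _ => by simp) (fun _ _ _ => by simp) (fun _ _ _ => by simp)
      (fun _ _ _ => by simp)) w t =
      ∑ i ∈ (Coalgebra.Repr.arbitrary k t).index,
        TensorProduct.lift (LinearMap.mul k k) (TensorProduct.map
          (γ ∘ₗ LinearMap.mulLeft k ((Coalgebra.Repr.arbitrary k t).left i))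
          (ξ ∘ₗ LinearMap.mulLeft k ((Coalgebra.Repr.arbitrary k t).right i) ∘ₗ
            LinearMap.mul' k H ∘ₗ LinearMap.lTensor H (HopfAlgebra.antipode k))
          (TensorProduct.assoc k H H H (LinearMap.rTensor H Coalgebra.comul w))) := by
    intro w
    induction w using TensorProduct.induction_on with
    | zero => simp
    | add x y hx hy => simp only [map_add, LinearMap.add_apply, hx, hy, Finset.sum_add_distrib]
    | tmul a b =>
      rw [TensorProduct.lift.tmul, LinearMap.mk₂_apply, dualRight_apply, dualMul_apply,
        Bialgebra.comul_mul, ← (Coalgebra.Repr.arbitrary k t).eq, Finset.sum_mul, map_sum, map_sum]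
      refine Finset.sum_congr rfl fun i _ => ?_
      rw [LinearMap.rTensor_tmul]
      induction (Coalgebra.comul (R := k) a) using TensorProduct.induction_on with
      | zero => simp
      | add x y hx hy => simp only [mul_add, map_add, hx, hy, TensorProduct.add_tmul]
      | tmul c d => simp [mul_assoc]
  rw [gen, Coalgebra.coassoc_apply]
  simp only [key _ _ _ rfl]
  rw [dualMul_apply, ← (Coalgebra.Repr.arbitrary k t).eq, map_sum, map_sum]
  simp

/-- On the image of `𝓛` the algebra `H` acts through right translations on the factor `H^*`. -/
lemma homRep_leftMulMap (h : H) (γ : Dual k H) (T : V →ₗ[k] W) :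
    homRep k H V W h (leftMulMap k H V W (γ ⊗ₜ T)) =
      leftMulMap k H V W (dualRight h γ ⊗ₜ T) := by
  have gen : ∀ (w : H ⊗[k] H) (ξ : Dual k H) (v : V),
      conjAux k H V W w (leftMulMap k H V W (γ ⊗ₜ T)) (ξ ⊗ₜ v) =
        TensorProduct.lift (LinearMap.mk₂ k
          (fun a b => dualRight a (dualMul γ (dualRight (HopfAlgebra.antipode k b) ξ)))
          (fun _ _ _ => by simp) (fun _ _ _ => by simp) (fun _ _ _ => by simp)
          (fun _ _ _ => by simp)) w ⊗ₜ T v := by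
    intro w ξ v
    induction w using TensorProduct.induction_on with
    | zero => simp
    | add x y hx hy => simp only [map_add, LinearMap.add_apply, hx, hy, TensorProduct.add_tmul]
    | tmul a b => simp [conjAux_tmul, leftMulMap_tmul]
  refine TensorProduct.ext' fun ξ v => ?_
  rw [homRep, AlgHom.comp_apply, gen, leftMulMap_tmul]
  exact congrArg (· ⊗ₜ[k] T v) (conj_dualMul h γ ξ)

lemma stabAct_dualRight (D : LeftComoduleAlgebra k H K) (ρ : K →ₐ[k] Module.End k V)
    (x : K) (a : H) :
    LinearMap.rTensor V (dualRight (k := k) a) ∘ₗ stabAct D ρ x =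
      stabAct D ρ x ∘ₗ LinearMap.rTensor V (dualRight (k := k) a) := by
  have gen : ∀ w : H ⊗[k] K, LinearMap.rTensor V (dualRight (k := k) a) ∘ₗ
      TensorProduct.homTensorHomMap (RingHom.id k) (Dual k H) V (Dual k H) V
        (TensorProduct.map dualLeft ρ.toLinearMap w) =
      TensorProduct.homTensorHomMap (RingHom.id k) (Dual k H) V (Dual k H) V
        (TensorProduct.map dualLeft ρ.toLinearMap w) ∘ₗ
          LinearMap.rTensor V (dualRight (k := k) a) := by
    intro w
    induction w using TensorProduct.induction_on with
    | zero => rw [map_zero, map_zero, LinearMap.comp_zero, LinearMap.zero_comp]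
    | add x y hx hy => rw [map_add, map_add, LinearMap.comp_add, LinearMap.add_comp, hx, hy]
    | tmul b c =>
      refine TensorProduct.ext' fun ξ v => ?_
      simp [dualLeft_dualRight]
  exact gen _

lemma homRep_mem_stabilizer (D : LeftComoduleAlgebra k H K)
    (ρ : K →ₐ[k] Module.End k V) (σ : K →ₐ[k] Module.End k W) (h : H)
    (φ : Dual k H ⊗[k] V →ₗ[k] Dual k H ⊗[k] W) (hφ : φ ∈ stabilizer D ρ σ) :
    homRep k H V W h φ ∈ stabilizer D ρ σ := by
  refine ⟨fun x => ?_, ?_⟩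
  · rw [homRep, AlgHom.comp_apply]
    induction (Bialgebra.comulAlgHom k H h) using TensorProduct.induction_on with
    | zero => simp
    | add x y hx hy =>
      simp only [map_add, LinearMap.add_apply, LinearMap.comp_add, LinearMap.add_comp, hx, hy]
    | tmul a b =>
      rw [conjAux_tmul, LinearMap.comp_assoc, LinearMap.comp_assoc, stabAct_dualRight,
        ← LinearMap.comp_assoc _ _ φ, hφ.1, ← LinearMap.comp_assoc, ← LinearMap.comp_assoc,
        stabAct_dualRight, LinearMap.comp_assoc, LinearMap.comp_assoc]
  · obtain ⟨z, rfl⟩ := hφ.2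
    clear hφ
    induction z using TensorProduct.induction_on with
    | zero => simp
    | add x y hx hy => rw [map_add, map_add]; exact add_mem hx hy
    | tmul γ T => exact ⟨_, (homRep_leftMulMap h γ T).symm⟩

/-- The `H`-module structure of the stabilizer. -/
def stabRep (D : LeftComoduleAlgebra k H K)
    (ρ : K →ₐ[k] Module.End k V) (σ : K →ₐ[k] Module.End k W) :
    H →ₐ[k] Module.End k (stabilizer D ρ σ) :=
  AlgHom.ofLinearMap
    { toFun := fun h => (homRep k H V W h).restrict (homRep_mem_stabilizer D ρ σ h)
      map_add' := fun _ _ => by ext1 φ; apply Subtype.ext; simp [LinearMap.restrict_apply]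
      map_smul' := fun _ _ => by ext1 φ; apply Subtype.ext; simp [LinearMap.restrict_apply] }
    (by ext1 φ; apply Subtype.ext; simp [LinearMap.restrict_apply])
    (fun _ _ => by ext1 φ; apply Subtype.ext; simp [LinearMap.restrict_apply])

lemma id_mem_stabilizer (D : LeftComoduleAlgebra k H K) (ρ : K →ₐ[k] Module.End k V) :
    LinearMap.id ∈ stabilizer D ρ ρ := by
  refine ⟨fun x => by simp, (Coalgebra.counit : Dual k H) ⊗ₜ LinearMap.id, ?_⟩
  refine TensorProduct.ext' fun ξ v => ?_
  rw [leftMulMap_tmul]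
  congr 1
  exact congrArg WithConv.ofConv (one_mul (WithConv.toConv ξ))

end Stabilizers

section Characters

variable {k H X : Type*} [Field k] [Ring H] [HopfAlgebra k H] [AddCommGroup X] [Module k X]

/-- The group `Â` of characters of `A`, with pointwise multiplication. -/
def Chars (k : Type*) [Field k] {G : Type*} [Group G] (A : Subgroup G) : Type _ := A →* kˣ

namespace Chars

variable {G : Type*} [Group G] {B : Subgroup G}

instance instCommGroupChars : CommGroup (Chars k B) := inferInstanceAs (CommGroup (B →* kˣ))

instance instFunLikeChars : FunLike (Chars k B) B kˣ := inferInstanceAs (FunLike (B →* kˣ) B kˣ)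

instance instMonoidHomClassChars : MonoidHomClass (Chars k B) B kˣ :=
  inferInstanceAs (MonoidHomClass (B →* kˣ) B kˣ)

instance instFintypeChars [Finite B] : Fintype (Chars k B) :=
  @Fintype.ofFinite _ (inferInstanceAs (Finite (B →* kˣ)))

@[simp] lemma mul_apply (μ ν : Chars k B) (a : B) : (μ * ν) a = μ a * ν a := rfl

@[simp] lemma one_apply (a : B) : (1 : Chars k B) a = 1 := rfl

@[simp] lemma inv_apply (μ : Chars k B) (a : B) : μ⁻¹ a = (μ a)⁻¹ := rfl

end Chars

variable {A : Subgroup (GroupLike k H)}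

/-- The isotypic component `X[μ]` of an `H`-module `X`. -/
def weightSpace (ρ : H →ₐ[k] Module.End k X) (μ : Chars k A) : Submodule k X where
  carrier := {x | ∀ a : A, ρ (a : GroupLike k H).val x = (μ a : k) • x}
  zero_mem' := fun _ => by simp
  add_mem' hx hy := fun a => by rw [map_add, hx a, hy a, smul_add]
  smul_mem' c x hx := fun a => by rw [map_smul, hx a, smul_comm]

/-- `C(μ) = {f ∈ H^* : f(a h) = μ(a) f(h)}`. -/
def charSpace (μ : Chars k A) : Submodule k (Dual k H) where
  carrier := {f | ∀ (a : A) (h : H), f ((a : GroupLike k H).val * h) = (μ a : k) * f h}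
  zero_mem' := fun _ _ => by simp
  add_mem' hx hy := fun a h => by
    rw [LinearMap.add_apply, LinearMap.add_apply, hx a h, hy a h, mul_add]
  smul_mem' c x hx := fun a h => by
    rw [LinearMap.smul_apply, LinearMap.smul_apply, hx a h, smul_eq_mul, smul_eq_mul]; ring

/-- The `H`-module structure of `C(μ)`: `(h · f)(t) = f(t h)`. -/
def charRep (μ : Chars k A) : H →ₐ[k] Module.End k (charSpace (H := H) μ) :=
  have hmem : ∀ h : H, ∀ f ∈ charSpace (H := H) μ, dualRight h f ∈ charSpace (H := H) μ :=
    fun h f hf a t => by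
      rw [dualRight_apply, dualRight_apply, mul_assoc]; exact hf a _
  AlgHom.ofLinearMap
    { toFun := fun h => (dualRight (k := k) h).restrict (hmem h)
      map_add' := fun _ _ => by ext1 φ; apply Subtype.ext; simp [LinearMap.restrict_apply]
      map_smul' := fun _ _ => by ext1 φ; apply Subtype.ext; simp [LinearMap.restrict_apply] }
    (by ext1 φ; apply Subtype.ext; simp [LinearMap.restrict_apply])
    (fun _ _ => by ext1 φ; apply Subtype.ext; simp [LinearMap.restrict_apply])

/-- For `x ∈ X[μ]` and `f ∈ X^*`, the functional `h ↦ f(S(h) x)`. -/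
def matrixCoeff (ρ : H →ₐ[k] Module.End k X) (x : X) (f : Dual k X) : Dual k H :=
  f ∘ₗ (LinearMap.applyₗ x) ∘ₗ ρ.toLinearMap ∘ₗ HopfAlgebra.antipode k

lemma matrixCoeff_mem (ρ : H →ₐ[k] Module.End k X) {μ ν : Chars k A} (hμν : ν = μ⁻¹) {x : X}
    (hx : x ∈ weightSpace ρ μ) (f : Dual k X) : matrixCoeff ρ x f ∈ charSpace (H := H) ν := by
  subst hμν
  intro a h
  have h1 : ρ (HopfAlgebra.antipode k (a : GroupLike k H).val) x = (μ⁻¹ a : k) • x := by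
    have := hx a⁻¹
    simpa using this
  simp [matrixCoeff, HopfAlgebra.antipode_mul_antidistrib, h1]

/-- The minimal idempotent `P_μ = |A|⁻¹ ∑ μ(a⁻¹) a`. -/
def idem [Fintype A] (μ : Chars k A) : H :=
  (Fintype.card A : k)⁻¹ • ∑ a : A, (μ a⁻¹ : k) • (a : GroupLike k H).val

end Characters

section Dynamical

variable {k : Type*} {H : Type w} [Field k] [Ring H] [HopfAlgebra k H]

open Algebra.TensorProduct in
/-- Dynamical twists for `H` (relative to `A`). -/
structure IsDynamicalTwist {A : Subgroup (GroupLike k H)} [Fintype A]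
    (J : Chars k A → H ⊗[k] H) : Prop where
  isUnit : ∀ lam, IsUnit (J lam)
  comm : ∀ lam, ∀ a : A,
    J lam * ((a : GroupLike k H).val ⊗ₜ (a : GroupLike k H).val) =
      ((a : GroupLike k H).val ⊗ₜ (a : GroupLike k H).val) * J lam
  cocycle : ∀ lam,
    Algebra.TensorProduct.assoc k k k H H H
      (∑ μ : Chars k A,
        map (Bialgebra.comulAlgHom k H) (AlgHom.id k H) (J lam) *
          (J (lam * μ⁻¹) ⊗ₜ[k] idem (H := H) μ)) =
      map (AlgHom.id k H) (Bialgebra.comulAlgHom k H) (J lam) * (1 ⊗ₜ[k] J lam)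
  counit_left : ∀ lam, TensorProduct.lid k H
    (LinearMap.rTensor H (Coalgebra.counit (R := k) (A := H)) (J lam)) = 1
  counit_right : ∀ lam, TensorProduct.rid k H
    (LinearMap.lTensor H (Coalgebra.counit (R := k) (A := H)) (J lam)) = 1

variable {K : Type*} [Ring K] [Algebra k K] {A : Subgroup (GroupLike k H)}
  {V : Chars k A → Type*} [∀ lam, AddCommGroup (V lam)] [∀ lam, Module k (V lam)]

/-- `(K, {V_λ})` is a dynamical datum for `(H, A)`. -/
structure IsDynamicalDatum (D : LeftComoduleAlgebra k H K)
    (ρ : ∀ lam, K →ₐ[k] Module.End k (V lam)) : Prop where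
  finite : Module.Finite k K
  simple : D.IsHSimple
  semisimple : IsSemisimpleRing K
  coinvariants : D.HasTrivialCoinvariants
  irreducible : ∀ lam, IsIrreducibleMod (ρ lam)
  stab_iso : ∀ lam μ,
    Nonempty (ModIso (stabRep D (ρ lam) (ρ μ)) (charRep (H := H) (lam * μ⁻¹)))

/-- A choice of `H`-module isomorphisms `ω_{λ,μ} : St_K(V_λ, V_μ) ≃ C(λ μ⁻¹)` sending, for
`λ = μ`, the identity to the counit. -/
structure StabIsos (D : LeftComoduleAlgebra k H K)
    (ρ : ∀ lam, K →ₐ[k] Module.End k (V lam)) where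
  iso : ∀ lam μ, ModIso (stabRep D (ρ lam) (ρ μ)) (charRep (H := H) (lam * μ⁻¹))
  iso_id : ∀ lam, ((iso lam lam).toLinearEquiv ⟨LinearMap.id, id_mem_stabilizer D (ρ lam)⟩ :
    Dual k H) = Coalgebra.counit

variable {D : LeftComoduleAlgebra k H K} {ρ : ∀ lam, K →ₐ[k] Module.End k (V lam)}

/-- The maps `Ψ(λ, x) : X^* ⊗ V_λ → V_ν` for `x ∈ X[λ⁻¹ ν]`:
`Ψ(λ, x)(f ⊗ v)` is the value of `ω⁻¹(h ↦ f(S(h) x))` at `1 ⊗ v`, where `1 ∈ H^*` is the counit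
and `H^* ⊗ V_ν` is mapped to `V_ν` by evaluation of the functionals at `1 ∈ H`. -/
def StabIsos.psi (ω : StabIsos D ρ) (lam ν : Chars k A) {X : Type*} [AddCommGroup X] [Module k X]
    (ρX : H →ₐ[k] Module.End k X) (x : X) (hx : x ∈ weightSpace ρX (lam⁻¹ * ν))
    (f : Dual k X) (v : V lam) : V ν :=
  TensorProduct.lid k (V ν) (LinearMap.rTensor (V ν) (LinearMap.applyₗ (1 : H))
    (((ω.iso lam ν).toLinearEquiv.symm
      ⟨matrixCoeff ρX x f, matrixCoeff_mem ρX (by rw [mul_inv_rev, inv_inv, mul_comm]) hx f⟩).1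
        ((Coalgebra.counit : Dual k H) ⊗ₜ v)))

/-- `J` is the dynamical twist obtained from the dynamical datum, with the choice `ω` of
isomorphisms, by the exchange construction: there are invertible `I(λ) ∈ H ⊗ H` such that, for all
finite-dimensional `H`-modules `X`, `Y`, all `x ∈ X[λ⁻¹ ν]` and `y ∈ Y[ν⁻¹ κ]`,
`I(λ)(x ⊗ y)` is an element of `(X ⊗ Y)[λ⁻¹ κ]` for which `Ψ(λ, I(λ)(x ⊗ y))` is the composition
of `Ψ(λ, x)` and `Ψ(ν, y)`, where `(X ⊗ Y)^*` is identified with `Y^* ⊗ X^*`; and `J(λ)` is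
`S⁻¹(I⁻²(λ)) ⊗ S⁻¹(I⁻¹(λ))`, where `I(λ)⁻¹ = I⁻¹(λ) ⊗ I⁻²(λ)`. -/
def IsAssociatedTwist (ω : StabIsos D ρ) (J : Chars k A → H ⊗[k] H) : Prop :=
  ∃ I : Chars k A → (H ⊗[k] H)ˣ,
    (∀ (X Y : Type w) [AddCommGroup X] [Module k X] [Module.Finite k X]
      [AddCommGroup Y] [Module k Y] [Module.Finite k Y]
      (ρX : H →ₐ[k] Module.End k X) (ρY : H →ₐ[k] Module.End k Y)
      (lam ν κ : Chars k A) (x : X) (y : Y)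
      (hx : x ∈ weightSpace ρX (lam⁻¹ * ν)) (hy : y ∈ weightSpace ρY (ν⁻¹ * κ)),
      ∃ hxy : outerRep ρX ρY (I lam) (x ⊗ₜ y) ∈ weightSpace (tensorRep ρX ρY) (lam⁻¹ * κ),
        ∀ (f : Dual k X) (f' : Dual k Y) (v : V lam),
          ω.psi lam κ (tensorRep ρX ρY) (outerRep ρX ρY (I lam) (x ⊗ₜ y)) hxy
              (TensorProduct.dualDistrib k X Y (f ⊗ₜ f')) v =
            ω.psi ν κ ρY y hy f' (ω.psi lam ν ρX x hx f v)) ∧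
    ∀ lam, J lam = TensorProduct.map (antipodeInv k H) (antipodeInv k H)
      (TensorProduct.comm k H H ((I lam)⁻¹ : (H ⊗[k] H)ˣ))

end Dynamical

section GroupAlgebra

variable {k H : Type*} [Field k] [Ring H] [HopfAlgebra k H] (A : Subgroup (GroupLike k H))

/-- The group algebra `k[A]` as a left `H`-comodule algebra, with coaction `a ↦ a ⊗ a`. -/
def groupAlgebraComodule : LeftComoduleAlgebra k H (MonoidAlgebra k A) where
  coact := MonoidAlgebra.lift k (H ⊗[k] MonoidAlgebra k A) A
    { toFun := fun a => (a : GroupLike k H).val ⊗ₜ MonoidAlgebra.of k A a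
      map_one' := by simp [Algebra.TensorProduct.one_def, MonoidAlgebra.one_def]
      map_mul' := fun a b => by simp }
  coassoc := fun x => by
    induction x using MonoidAlgebra.induction_on with
    | of a => simp
    | add x y hx hy => simp only [map_add, hx, hy]
    | smul c x hx => simp only [map_smul, hx]
  counit_coact := fun x => by
    induction x using MonoidAlgebra.induction_on with
    | of a => simp
    | add x y hx hy => simp only [map_add, hx, hy]
    | smul c x hx => simp only [map_smul, hx]

variable {A}

/-- The one-dimensional representation `k_χ` of `k[A]` afforded by the character `χ`. -/
def charMod (χ : Chars k A) : MonoidAlgebra k A →ₐ[k] Module.End k k :=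
  MonoidAlgebra.lift k (Module.End k k) A
    ((algebraMap k (Module.End k k) : k →* Module.End k k).comp
      ((Units.coeHom k).comp (χ : A →* kˣ)))

lemma charMod_of (χ : Chars k A) (a : A) (c : k) :
    charMod χ (MonoidAlgebra.of k A a) c = (χ a : k) * c := by
  simp [charMod]
  exact Or.inl rfl

end GroupAlgebra

end DynTwist

end

/-! Because the modules $\Bbbk_{f(\lambda)}$ are one-dimensional, every element of the image of
`leftMulMap` is determined by a functional $\gamma$. Commuting with $A$ means
$f(\lambda)(a)\,\gamma(at)=f(\mu)(a)\,\gamma(t)$ (`leftMulMap_mem_stabilizer_iff`). Left translation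
by $g(\lambda,\mu)$ turns $C(\lambda\mu^{-1})$ into exactly this space, by the relation between $f$
and $g$ (`Conjugates.dualPull_iff`, `stabIso`). The value $S(g)=g^{-1}$ then gives the formula for
$\Psi$. The other datum axioms hold because group-likes are linearly independent.

Composing two maps $\Psi$ forces $I(\lambda)(x\otimes
y)=g(\lambda,\kappa)g(\lambda,\nu)^{-1}x\otimes g(\lambda,\kappa)g(\nu,\kappa)^{-1}y$ for $x$, $y$
of weights $\lambda^{-1}\nu$, $\nu^{-1}\kappa$. Conjugation by $g(\lambda,\nu)^{-1}$ sends the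
weight $\nu\lambda^{-1}$ to $f(\lambda)f(\nu)^{-1}$, so the total weight telescopes and is preserved
(`conjChar_exchange_mul`). The induced map on pairs of weights is injective because $f$ is
(`exchange_injective`), so $I(\lambda)$ permutes the idempotents $P_\mu\otimes P_\eta$ up to
group-likes and is invertible. Applying $S^{-1}\otimes S^{-1}$ and the flip to its inverse gives
$J$.

The twist axioms are checked directly for $J$: on $P_\alpha\otimes P_\beta\otimes P_\gamma$ the
cocycle equation becomes three cancellations between products of values of $g$
(`groupTwist_cocycle`).

The $K$-action and $J$ involve $S^{-1}$, defined as a ring inverse that is $0$ on non-units, so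
bijectivity of the antipode is proved as well (`antipode_bijective`), through a nonzero left
integral. -/

namespace DynTwist

/-! ### Bijectivity of the antipode in finite dimension. -/

section Antipode

open Coalgebra HopfAlgebra

variable {k H : Type*} [Field k] [Ring H] [HopfAlgebra k H]

variable (k H) in
/-- The pairing `(c, φ) ↦ φ(c · )`. -/
noncomputable def dualPull : H →ₗ[k] Dual k H →ₗ[k] Dual k H :=
  LinearMap.mk₂ k (fun c φ => φ ∘ₗ LinearMap.mulLeft k c)
    (fun _ _ _ => by ext; simp [add_mul]) (fun _ _ _ => by ext; simp)
    (fun _ _ _ => by ext; simp) (fun _ _ _ => by ext; simp)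

lemma dualPull_apply (c t : H) (φ : Dual k H) : dualPull k H c φ t = φ (c * t) := rfl

lemma dualPull_dualPull (c d : H) (φ : Dual k H) :
    dualPull k H c (dualPull k H d φ) = dualPull k H (d * c) φ := by
  ext t; simp [dualPull_apply, mul_assoc]

lemma dualPull_one (φ : Dual k H) : dualPull k H 1 φ = φ := by
  ext t; simp [dualPull_apply]

/-- The operator `a ⊗ φ ↦ a₍₁₎ ⊗ φ(B(a₍₂₎) · )` on `H ⊗ H^*`. -/
noncomputable def twistMap (B : H →ₗ[k] H) : H ⊗[k] Dual k H →ₗ[k] H ⊗[k] Dual k H :=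
  LinearMap.lTensor H (TensorProduct.lift (dualPull k H ∘ₗ B)) ∘ₗ
    (TensorProduct.assoc k H H (Dual k H)).toLinearMap ∘ₗ LinearMap.rTensor (Dual k H) comul

/-- The map `c ⊗ d ↦ B(d) C(c)`. -/
noncomputable def mulSwap (B C : H →ₗ[k] H) : H ⊗[k] H →ₗ[k] H :=
  LinearMap.mul' k H ∘ₗ (TensorProduct.comm k H H).toLinearMap ∘ₗ TensorProduct.map C B

lemma mulSwap_tmul (B C : H →ₗ[k] H) (c d : H) : mulSwap B C (c ⊗ₜ d) = B d * C c := by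
  simp [mulSwap]

lemma twistMap_tmul (B : H →ₗ[k] H) (a : H) (φ : Dual k H) :
    twistMap B (a ⊗ₜ φ) =
      LinearMap.lTensor H ((dualPull k H).flip φ ∘ₗ B) (comul a) := by
  simp only [twistMap, LinearMap.comp_apply, LinearMap.rTensor_tmul]
  generalize (comul a : H ⊗[k] H) = w
  induction w using TensorProduct.induction_on with
  | zero => simp
  | add x y hx hy => simp only [TensorProduct.add_tmul, map_add, hx, hy]
  | tmul b c => simp

lemma lTensor_mulSwap_comul {B C : H →ₗ[k] H}
    (hBC : ∀ a : H, mulSwap B C (comul a) = algebraMap k H (counit a)) (a : H) :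
    LinearMap.lTensor H (mulSwap B C)
      (TensorProduct.assoc k H H H (LinearMap.rTensor H comul (comul (R := k) a))) =
      a ⊗ₜ 1 := by
  have e : mulSwap B C ∘ₗ comul = Algebra.linearMap k H ∘ₗ counit := LinearMap.ext hBC
  rw [coassoc_apply, ← LinearMap.comp_apply, ← LinearMap.lTensor_comp, e, LinearMap.lTensor_comp,
    LinearMap.comp_apply, lTensor_counit_comul]
  simp

/-- The composite is $a\otimes\varphi\mapsto a_{(1)}\otimes\varphi(B(a_{(3)})C(a_{(2)})\,\cdot\,)$,
which collapses by the hypothesis. It is applied with $\{B,C\}=\{S,S^2\}$, so that `twistMap` of $S$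
and of $S^2$ are mutually inverse without $S^{-1}$ being available. -/
lemma twistMap_twistMap {B C : H →ₗ[k] H}
    (hBC : ∀ a : H, mulSwap B C (comul a) = algebraMap k H (counit a)) (z : H ⊗[k] Dual k H) :
    twistMap C (twistMap B z) = z := by
  induction z using TensorProduct.induction_on with
  | zero => simp
  | add x y hx hy => simp only [map_add, hx, hy]
  | tmul a φ =>
    have gen : ∀ w : H ⊗[k] H,
        twistMap C (LinearMap.lTensor H ((dualPull k H).flip φ ∘ₗ B) w) =
        LinearMap.lTensor H ((dualPull k H).flip φ) (LinearMap.lTensor H (mulSwap B C)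
          (TensorProduct.assoc k H H H (LinearMap.rTensor H comul w))) := by
      intro w
      induction w using TensorProduct.induction_on with
      | zero => simp
      | add x y hx hy => simp only [map_add, hx, hy]
      | tmul b c =>
        rw [LinearMap.lTensor_tmul, twistMap_tmul, LinearMap.rTensor_tmul]
        generalize (comul b : H ⊗[k] H) = v
        induction v using TensorProduct.induction_on with
        | zero => simp
        | add x y hx hy => simp only [TensorProduct.add_tmul, map_add, hx, hy]
        | tmul d e => simp [mulSwap_tmul, dualPull_dualPull]
    rw [twistMap_tmul, gen, lTensor_mulSwap_comul hBC]
    simp [dualPull_one]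

/-- $S(a_{(2)})S^2(a_{(1)})=S(S(a_{(1)})a_{(2)})$, since $S$ reverses products. -/
lemma mulSwap_antipode_sq (a : H) :
    mulSwap (antipode k) (antipode k ∘ₗ antipode k) (comul a) = algebraMap k H (counit a) := by
  have h : mulSwap (antipode k) (antipode k ∘ₗ antipode k) =
      antipode k ∘ₗ LinearMap.mul' k H ∘ₗ LinearMap.rTensor H (antipode k) :=
    TensorProduct.ext' fun x y => by simp [mulSwap_tmul, antipode_mul_antidistrib]
  rw [h, LinearMap.comp_apply, LinearMap.comp_apply, mul_antipode_rTensor_comul_apply]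
  simp [Algebra.algebraMap_eq_smul_one]

/-- $S^2(a_{(2)})S(a_{(1)})=S(a_{(1)}S(a_{(2)}))$. -/
lemma mulSwap_sq_antipode (a : H) :
    mulSwap (antipode k ∘ₗ antipode k) (antipode k) (comul a) = algebraMap k H (counit a) := by
  have h : mulSwap (antipode k ∘ₗ antipode k) (antipode k) =
      antipode k ∘ₗ LinearMap.mul' k H ∘ₗ LinearMap.lTensor H (antipode k) :=
    TensorProduct.ext' fun x y => by simp [mulSwap_tmul, antipode_mul_antidistrib]
  rw [h, LinearMap.comp_apply, LinearMap.comp_apply, mul_antipode_lTensor_comul_apply]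
  simp [Algebra.algebraMap_eq_smul_one]

variable (k H) in
/-- The map `b ⊗ c ↦ (a ⊗ φ ↦ b a ⊗ φ(S(c) · ))`. -/
noncomputable def adjointMap : H ⊗[k] H →ₗ[k] Module.End k (H ⊗[k] Dual k H) :=
  TensorProduct.homTensorHomMap (RingHom.id k) H (Dual k H) H (Dual k H) ∘ₗ
    TensorProduct.map (LinearMap.mul k H) (dualPull k H ∘ₗ antipode k)

lemma adjointMap_tmul (b c a : H) (φ : Dual k H) :
    adjointMap k H (b ⊗ₜ c) (a ⊗ₜ φ) = (b * a) ⊗ₜ dualPull k H (antipode k c) φ := rfl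

/-- On $a\otimes\varphi$ the left side is
$h_{(1)}a_{(1)}\otimes\varphi(S(h_{(3)})S^2(h_{(2)})S^2(a_{(2)})\,\cdot\,)$ and the factors in
$h_{(2)},h_{(3)}$ cancel. The adjoint action is thereby straightened to left multiplication, so its
invariants become integrals. -/
lemma twistMap_adjointMap (h : H) (z : H ⊗[k] Dual k H) :
    twistMap (antipode k ∘ₗ antipode k) (adjointMap k H (comul h) z) =
      LinearMap.rTensor (Dual k H) (LinearMap.mulLeft k h)
        (twistMap (antipode k ∘ₗ antipode k) z) := by
  induction z using TensorProduct.induction_on with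
  | zero => simp
  | add x y hx hy => simp only [map_add, hx, hy]
  | tmul a φ =>
    let N : H ⊗[k] H →ₗ[k] H ⊗[k] H →ₗ[k] H ⊗[k] Dual k H :=
      LinearMap.compr₂ (LinearMap.mul k (H ⊗[k] H)).flip
        (LinearMap.lTensor H ((dualPull k H).flip φ)) ∘ₗ
        LinearMap.lTensor H (antipode k ∘ₗ antipode k)
    have hN : ∀ x y c d : H, N (c ⊗ₜ d) (x ⊗ₜ y) =
        (x * c) ⊗ₜ dualPull k H (y * antipode k (antipode k d)) φ := fun x y c d => by
      simp [N]
    have gen : ∀ w : H ⊗[k] H,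
        twistMap (antipode k ∘ₗ antipode k) (adjointMap k H w (a ⊗ₜ φ)) =
        N (comul a) (LinearMap.lTensor H (mulSwap (antipode k) (antipode k ∘ₗ antipode k))
          (TensorProduct.assoc k H H H (LinearMap.rTensor H comul w))) := by
      intro w
      induction w using TensorProduct.induction_on with
      | zero => simp
      | add x y hx hy => simp only [map_add, LinearMap.add_apply, hx, hy]
      | tmul b c =>
        rw [adjointMap_tmul, twistMap_tmul, LinearMap.rTensor_tmul, Bialgebra.comul_mul]
        generalize (comul a : H ⊗[k] H) = u
        generalize (comul b : H ⊗[k] H) = v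
        induction v using TensorProduct.induction_on with
        | zero => simp
        | add x y hx hy => simp only [add_mul, TensorProduct.add_tmul, map_add, hx, hy]
        | tmul d e =>
          induction u using TensorProduct.induction_on with
          | zero => simp
          | add x y hx hy => simp only [mul_add, map_add, LinearMap.add_apply, hx, hy]
          | tmul p q =>
            simp [hN, mulSwap_tmul, antipode_mul_antidistrib, dualPull_dualPull, mul_assoc]
    rw [gen, lTensor_mulSwap_comul mulSwap_antipode_sq, twistMap_tmul]
    generalize (comul a : H ⊗[k] H) = u
    induction u using TensorProduct.induction_on with
    | zero => simp
    | add x y hx hy => simp only [map_add, LinearMap.add_apply, hx, hy]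
    | tmul p q => simp [hN]

/-- Evaluation of `a ⊗ φ` as the operator `x ↦ φ(x) a`. -/
noncomputable def tensorDualHom : H ⊗[k] Dual k H →ₗ[k] H →ₗ[k] H :=
  dualTensorHom k H H ∘ₗ (TensorProduct.comm k H (Dual k H)).toLinearMap

lemma tensorDualHom_tmul (a x : H) (φ : Dual k H) : tensorDualHom (a ⊗ₜ φ) x = φ x • a := by
  simp [tensorDualHom]

lemma tensorDualHom_bijective [Module.Finite k H] :
    Function.Bijective (tensorDualHom : H ⊗[k] Dual k H →ₗ[k] H →ₗ[k] H) := by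
  have h : (tensorDualHom : H ⊗[k] Dual k H →ₗ[k] H →ₗ[k] H) =
      ((TensorProduct.comm k H (Dual k H)).trans
        (dualTensorHomEquiv k H H)).toLinearMap := by
    refine TensorProduct.ext' fun a φ => ?_
    ext x
    simp [tensorDualHom]
  rw [h]
  exact LinearEquiv.bijective _

/-- A nonzero finite-dimensional Hopf algebra has a nonzero left integral. -/
lemma exists_left_integral [Module.Finite k H] :
    ∃ t : H, t ≠ 0 ∧ ∀ h : H, h * t = counit (R := k) h • t := by
  have : Nontrivial H := (Bialgebra.counitAlgHom k H).toRingHom.domain_nontrivial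
  obtain ⟨I, hI⟩ := (tensorDualHom_bijective (k := k) (H := H)).2 LinearMap.id
  -- The identity operator is invariant under the adjoint action:
  -- $h_{(1)}S(h_{(2)})x=\varepsilon(h)x$.
  have hadj : ∀ h : H, adjointMap k H (comul h) I = counit (R := k) h • I := by
    intro h
    apply tensorDualHom_bijective.1
    have gen : ∀ (w : H ⊗[k] H) (z : H ⊗[k] Dual k H) (x : H),
        tensorDualHom (adjointMap k H w z) x =
          LinearMap.mul' k H (TensorProduct.map LinearMap.id
            (tensorDualHom z ∘ₗ LinearMap.mulRight k x ∘ₗ antipode k) w) := by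
      intro w z x
      induction w using TensorProduct.induction_on with
      | zero => simp
      | add p q hp hq => simp only [map_add, LinearMap.add_apply, hp, hq]
      | tmul b c =>
        induction z using TensorProduct.induction_on with
        | zero => simp
        | add p q hp hq =>
          simp only [map_add, LinearMap.add_apply, hp, hq]
          simp [mul_add]
        | tmul a φ => simp [adjointMap_tmul, tensorDualHom_tmul, dualPull_apply]
    ext x
    rw [gen, hI, map_smul, hI, LinearMap.id_comp]
    have e : LinearMap.mul' k H ∘ₗ
        TensorProduct.map LinearMap.id (LinearMap.mulRight k x ∘ₗ antipode k) =
        LinearMap.mulRight k x ∘ₗ LinearMap.mul' k H ∘ₗ LinearMap.lTensor H (antipode k) :=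
      TensorProduct.ext' fun p q => by simp [mul_assoc]
    rw [← LinearMap.comp_apply, e, LinearMap.comp_apply, LinearMap.comp_apply,
      mul_antipode_lTensor_comul_apply]
    simp [Algebra.algebraMap_eq_smul_one]
  -- Straightening the invariant `I` gives a nonzero $u$ with $(h\otimes1)u=\varepsilon(h)u$;
  -- evaluating its second factor at a suitable $x$ leaves the integral.
  set u := twistMap (antipode k ∘ₗ antipode k) I with hu
  have hu0 : tensorDualHom u ≠ 0 := by
    intro h0
    have h1 : u = 0 := tensorDualHom_bijective.1 (by rw [h0, map_zero])
    have h2 : I = 0 := by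
      rw [← twistMap_twistMap mulSwap_sq_antipode I, ← hu, h1, map_zero]
    rw [h2, map_zero] at hI
    exact one_ne_zero (α := H) (LinearMap.congr_fun hI 1).symm
  obtain ⟨x, hx⟩ : ∃ x, tensorDualHom u x ≠ 0 := by
    by_contra! h
    exact hu0 (LinearMap.ext h)
  refine ⟨tensorDualHom u x, hx, fun h => ?_⟩
  have h1 : LinearMap.rTensor (Dual k H) (LinearMap.mulLeft k h) u = counit (R := k) h • u := by
    rw [hu, ← twistMap_adjointMap, hadj, map_smul]
  have h2 : ∀ z : H ⊗[k] Dual k H,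
      tensorDualHom (LinearMap.rTensor (Dual k H) (LinearMap.mulLeft k h) z) x =
        h * tensorDualHom z x := by
    intro z
    induction z using TensorProduct.induction_on with
    | zero => simp
    | add p q hp hq => simp only [map_add, LinearMap.add_apply, hp, hq, mul_add]
    | tmul a φ => simp [tensorDualHom_tmul]
  rw [← h2, h1, map_smul, LinearMap.smul_apply]

/-- For a left integral `t` one has `x t₍₁₎ ⊗ S(t₍₂₎) = t₍₁₎ ⊗ S(t₍₂₎) x`. -/
lemma mul_comul_left_integral {t : H} (ht : ∀ h : H, h * t = counit (R := k) h • t) (x : H) :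
    (x ⊗ₜ[k] 1) * LinearMap.lTensor H (antipode k) (comul t) =
      LinearMap.lTensor H (LinearMap.mulRight k x ∘ₗ antipode k) (comul t) := by
  let N : H ⊗[k] H →ₗ[k] H ⊗[k] H :=
    LinearMap.lTensor H (LinearMap.mul' k H) ∘ₗ (TensorProduct.assoc k H H H).toLinearMap ∘ₗ
      LinearMap.rTensor H (LinearMap.lTensor H (antipode k) ∘ₗ comul)
  let P : H ⊗[k] H →ₗ[k] H ⊗[k] H →ₗ[k] H ⊗[k] H :=
    TensorProduct.homTensorHomMap (RingHom.id k) H H H H ∘ₗ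
      TensorProduct.map (LinearMap.mul k H).flip (LinearMap.mul k H ∘ₗ antipode k)
  have hP : ∀ p q a b : H, P (p ⊗ₜ q) (a ⊗ₜ b) = (a * p) ⊗ₜ (antipode k q * b) :=
    fun _ _ _ _ => rfl
  -- For $w=\Delta(x)$ both sides are $x_{(1)}t_{(1)}\otimes S(x_{(2)}t_{(2)})x_{(3)}$. One reduces
  -- by $x_{(1)}t\otimes x_{(2)}=t\otimes x$, the other by
  -- $S(x_{(2)})x_{(3)}=\varepsilon(x_{(2)})1$.
  have gen : ∀ w : H ⊗[k] H, N (LinearMap.rTensor H (LinearMap.mulRight k t) w) =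
      P (comul t) (LinearMap.lTensor H (LinearMap.mul' k H ∘ₗ LinearMap.rTensor H (antipode k))
        (TensorProduct.assoc k H H H (LinearMap.rTensor H comul w))) := by
    intro w
    induction w using TensorProduct.induction_on with
    | zero => simp
    | add x y hx hy => simp only [map_add, hx, hy]
    | tmul b c =>
      simp only [N, LinearMap.comp_apply, LinearMap.rTensor_tmul, LinearMap.mulRight_apply,
        Bialgebra.comul_mul]
      generalize (comul t : H ⊗[k] H) = u
      generalize (comul b : H ⊗[k] H) = v
      induction v using TensorProduct.induction_on with
      | zero => simp
      | add x y hx hy => simp only [add_mul, TensorProduct.add_tmul, map_add, hx, hy]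
      | tmul d e =>
        induction u using TensorProduct.induction_on with
        | zero => simp
        | add x y hx hy =>
          simp only [mul_add, map_add, TensorProduct.add_tmul, LinearMap.add_apply, hx, hy]
        | tmul p q => simp [hP, antipode_mul_antidistrib, mul_assoc]
  have e1 : LinearMap.rTensor H (LinearMap.mulRight k t) (comul x) = t ⊗ₜ[k] x := by
    have e : LinearMap.mulRight k t = LinearMap.toSpanSingleton k H t ∘ₗ counit :=
      LinearMap.ext fun h => by simp [ht]
    rw [e, LinearMap.rTensor_comp, LinearMap.comp_apply, rTensor_counit_comul]
    simp
  have e2 : LinearMap.lTensor H (LinearMap.mul' k H ∘ₗ LinearMap.rTensor H (antipode k))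
      (TensorProduct.assoc k H H H (LinearMap.rTensor H comul (comul (R := k) x))) = x ⊗ₜ 1 := by
    rw [coassoc_apply, ← LinearMap.comp_apply, ← LinearMap.lTensor_comp, LinearMap.comp_assoc,
      mul_antipode_rTensor_comul, LinearMap.lTensor_comp, LinearMap.comp_apply,
      lTensor_counit_comul]
    simp
  have h := gen (comul x)
  rw [e1, e2] at h
  simp only [N, LinearMap.comp_apply, LinearMap.rTensor_tmul] at h
  generalize (comul t : H ⊗[k] H) = u at h ⊢
  calc _ = P u (x ⊗ₜ 1) := by
        clear h
        induction u using TensorProduct.induction_on with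
        | zero => simp
        | add x y hx hy => simp only [map_add, mul_add, LinearMap.add_apply, hx, hy]
        | tmul p q => simp [hP]
    _ = _ := by
        rw [← h]
        clear h
        induction u using TensorProduct.induction_on with
        | zero => simp
        | add x y hx hy => simp only [map_add, TensorProduct.add_tmul, hx, hy]
        | tmul p q => simp

/-- The antipode of a finite-dimensional Hopf algebra is bijective. -/
lemma antipode_bijective [Module.Finite k H] :
    Function.Bijective (antipode k : H →ₗ[k] H) := by
  suffices hs : Function.Surjective (antipode k : H →ₗ[k] H) from
    ⟨LinearMap.injective_iff_surjective.2 hs, hs⟩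
  rw [← LinearMap.range_eq_top]
  by_contra hne
  obtain ⟨φ, hφ0, hφ⟩ := Submodule.exists_le_ker_of_lt_top _ (lt_top_iff_ne_top.2 hne)
  have hφS : φ ∘ₗ antipode k = 0 :=
    LinearMap.ext fun h => hφ ⟨h, rfl⟩
  obtain ⟨t, ht0, ht⟩ := exists_left_integral (k := k) (H := H)
  -- The element sends $x$ to $\varphi(S(t_{(2)})x)\,t_{(1)}=\varphi(S(t_{(2)}))\,xt_{(1)}$, and
  -- $\varphi$ kills the range of $S$. Injectivity of `twistMap` then forces $t\otimes\varphi=0$.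
  have key : twistMap (antipode k) (t ⊗ₜ φ) = 0 := by
    apply tensorDualHom_bijective.1
    ext x
    have e1 : ∀ w : H ⊗[k] H, tensorDualHom (LinearMap.lTensor H
        ((dualPull k H).flip φ ∘ₗ antipode k) w) x = TensorProduct.rid k H
          (LinearMap.lTensor H φ (LinearMap.lTensor H (LinearMap.mulRight k x ∘ₗ antipode k) w)) := by
      intro w
      induction w using TensorProduct.induction_on with
      | zero => simp
      | add p q hp hq => simp only [map_add, LinearMap.add_apply, hp, hq]
      | tmul a b => simp [tensorDualHom_tmul, dualPull_apply]
    have e2 : ∀ w : H ⊗[k] H, LinearMap.lTensor H φ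
        ((x ⊗ₜ[k] 1) * LinearMap.lTensor H (antipode k) w) = 0 := by
      intro w
      induction w using TensorProduct.induction_on with
      | zero => simp
      | add p q hp hq => simp only [map_add, mul_add, hp, hq, add_zero]
      | tmul a b =>
        have := LinearMap.congr_fun hφS b
        simp only [LinearMap.comp_apply, LinearMap.zero_apply] at this
        simp [this]
    rw [twistMap_tmul, e1, ← mul_comul_left_integral ht, e2]
    simp
  have h0 : t ⊗ₜ[k] φ = 0 := by
    rw [← twistMap_twistMap mulSwap_antipode_sq (t ⊗ₜ[k] φ)]
    rw [key, map_zero]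
  refine hφ0 (LinearMap.ext fun x => ?_)
  have h1 : φ x • t = 0 := by rw [← tensorDualHom_tmul, h0, map_zero, LinearMap.zero_apply]
  exact (smul_eq_zero.1 h1).resolve_right ht0

lemma antipodeInv_antipode [Module.Finite k H] (h : H) :
    antipodeInv k H (antipode k h) = h := by
  have hu : IsUnit (antipode k (A := H) : Module.End k H) :=
    (Module.End.isUnit_iff _).2 antipode_bijective
  exact LinearMap.congr_fun (Ring.inverse_mul_cancel _ hu) h

end Antipode

/-! ### Stabilizers of one-dimensional modules over the group algebra. -/

section GroupAlgebraStabilizer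

open Coalgebra HopfAlgebra

variable {k H : Type*} [Field k] [Ring H] [HopfAlgebra k H]

/-- From $\Delta(a)=a\otimes a$: group-likes act on $H^*$ by algebra automorphisms. This moves the
$A$-action through $\mathcal L(\gamma\otimes T)$ onto $\gamma$. -/
lemma dualPull_groupLike_dualMul (a : GroupLike k H) (γ ξ : Dual k H) :
    dualPull k H a.val (dualMul γ ξ) =
      dualMul (dualPull k H a.val γ) (dualPull k H a.val ξ) := by
  ext t
  rw [dualPull_apply, dualMul_apply, dualMul_apply, Bialgebra.comul_mul,
    a.isGroupLikeElem_val.comul_eq_tmul_self]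
  generalize (comul t : H ⊗[k] H) = w
  induction w using TensorProduct.induction_on with
  | zero => simp
  | add x y hx hy => simp only [mul_add, map_add, hx, hy]
  | tmul b c => simp [dualPull_apply]

lemma dualPull_groupLike_counit (a : GroupLike k H) :
    dualPull k H a.val (counit : Dual k H) = counit := by
  ext t
  simp [dualPull_apply]

lemma dualMul_counit (γ : Dual k H) : dualMul γ (counit : Dual k H) = γ :=
  congrArg WithConv.ofConv (mul_one (WithConv.toConv γ))

lemma antipodeInv_groupLike [Module.Finite k H] (a : GroupLike k H) :
    antipodeInv k H a.val = a⁻¹.val := by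
  conv_lhs => rw [← inv_inv a, GroupLike.val_inv]
  exact antipodeInv_antipode _

lemma dualPull_val_dualPull_val (a b : GroupLike k H) (φ : Dual k H) :
    dualPull k H a.val (dualPull k H b.val φ) = dualPull k H (b * a).val φ := by
  rw [dualPull_dualPull]; rfl

lemma dualPull_val_one (φ : Dual k H) : dualPull k H (1 : GroupLike k H).val φ = φ :=
  dualPull_one φ

variable {A : Subgroup (GroupLike k H)}

lemma stabAct_groupAlgebra_of [Module.Finite k H] (χ : Chars k A) (a : A) (ξ : Dual k H) (v : k) :
    stabAct (groupAlgebraComodule A) (charMod χ) (MonoidAlgebra.of k A a) (ξ ⊗ₜ v) =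
      dualPull k H (a⁻¹ : A).1.val ξ ⊗ₜ[k] ((χ a : k) * v) := by
  have h : (groupAlgebraComodule A).coact (MonoidAlgebra.of k A a) =
      (a : GroupLike k H).val ⊗ₜ MonoidAlgebra.of k A a := by
    simp [groupAlgebraComodule]
  have h2 : dualLeft (a : GroupLike k H).val ξ = dualPull k H (a⁻¹ : A).1.val ξ := by
    change dualPull k H (antipodeInv k H (a : GroupLike k H).val) ξ = _
    rw [antipodeInv_groupLike]; rfl
  rw [← h2, ← charMod_of]
  simp only [stabAct, LinearMap.comp_apply, AlgHom.toLinearMap_apply, h, TensorProduct.map_tmul]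
  rfl

lemma leftMulMap_mem_stabilizer_iff [Module.Finite k H] (χ₁ χ₂ : Chars k A) (γ : Dual k H) :
    leftMulMap k H k k (γ ⊗ₜ LinearMap.id) ∈
        stabilizer (groupAlgebraComodule A) (charMod χ₁) (charMod χ₂) ↔
      ∀ (a : A) (t : H), (χ₁ a : k) * γ ((a : GroupLike k H).val * t) = (χ₂ a : k) * γ t := by
  have key : ∀ a : A, (∀ t : H, (χ₁ a : k) * γ ((a : GroupLike k H).val * t) = (χ₂ a : k) * γ t) ↔
      (χ₂ a : k) • dualPull k H (a⁻¹ : A).1.val γ = (χ₁ a : k) • γ := by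
    intro a
    constructor
    · intro h
      ext t
      have h1 := h ((a⁻¹ : A).1.val * t)
      have h2 : (a : GroupLike k H).val * ((a⁻¹ : A).1.val * t) = t := by
        rw [← mul_assoc]
        change ((a * a⁻¹ : A) : GroupLike k H).val * t = t
        rw [mul_inv_cancel]; exact one_mul t
      rw [h2] at h1
      simpa [dualPull_apply] using h1.symm
    · intro h t
      have h1 := LinearMap.congr_fun h ((a : GroupLike k H).val * t)
      have h2 : (a⁻¹ : A).1.val * ((a : GroupLike k H).val * t) = t := by
        rw [← mul_assoc]
        change ((a⁻¹ * a : A) : GroupLike k H).val * t = t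
        rw [inv_mul_cancel]; exact one_mul t
      rw [LinearMap.smul_apply, dualPull_apply, h2] at h1
      exact h1.symm
  simp only [key]
  constructor
  · intro h a
    -- The counit is the unit of $H^*$ and is fixed by translation by $a^{-1}$, so evaluating there
    -- isolates $\gamma$.
    have h1 := LinearMap.congr_fun (h.1 (MonoidAlgebra.of k A a)) ((counit : Dual k H) ⊗ₜ (1 : k))
    rw [LinearMap.comp_apply, LinearMap.comp_apply, stabAct_groupAlgebra_of, leftMulMap_tmul,
      leftMulMap_tmul, dualPull_groupLike_counit, dualMul_counit, LinearMap.id_apply,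
      LinearMap.id_apply, stabAct_groupAlgebra_of] at h1
    simpa using (congrArg (TensorProduct.rid k (Dual k H)) h1).symm
  · refine fun h => ⟨fun x => ?_, _, rfl⟩
    induction x using MonoidAlgebra.induction_on with
    | of a =>
      refine TensorProduct.ext' fun ξ v => ?_
      rw [LinearMap.comp_apply, LinearMap.comp_apply, stabAct_groupAlgebra_of, leftMulMap_tmul,
        leftMulMap_tmul, LinearMap.id_apply, LinearMap.id_apply, stabAct_groupAlgebra_of,
        dualPull_groupLike_dualMul, ← smul_eq_mul, ← smul_eq_mul, ← TensorProduct.smul_tmul,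
        ← TensorProduct.smul_tmul]
      have h1 := congrArg (fun γ' => dualMul γ' (dualPull k H (a⁻¹ : A).1.val ξ)) (h a)
      simp only [LinearMap.map_smul₂] at h1
      rw [h1]
    | add x y hx hy => rw [map_add, map_add, LinearMap.comp_add, LinearMap.add_comp, hx, hy]
    | smul c x hx => rw [map_smul, map_smul, LinearMap.comp_smul, LinearMap.smul_comp, hx]

/-- Endomorphisms of the line are scalars, so an element of the image of $\mathcal L$ is recovered
from its value at $\varepsilon\otimes1$. -/
lemma eq_leftMulMap_of_mem_range {φ : Dual k H ⊗[k] k →ₗ[k] Dual k H ⊗[k] k}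
    (hφ : φ ∈ LinearMap.range (leftMulMap k H k k)) :
    leftMulMap k H k k
      (TensorProduct.rid k (Dual k H) (φ ((counit : Dual k H) ⊗ₜ 1)) ⊗ₜ LinearMap.id) = φ := by
  obtain ⟨z, rfl⟩ := hφ
  induction z using TensorProduct.induction_on with
  | zero => simp
  | add x y hx hy =>
    simp only [map_add, LinearMap.add_apply, TensorProduct.add_tmul, hx, hy]
  | tmul γ T =>
    have hT : T = T 1 • LinearMap.id := by ext; simp
    rw [leftMulMap_tmul, dualMul_counit, TensorProduct.rid_tmul, TensorProduct.smul_tmul, ← hT]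

/-- The element `n` of the normalizer of `A` conjugates `θ⁻¹` into `χ₁ χ₂⁻¹`. -/
structure Conjugates (n : GroupLike k H) (χ₁ χ₂ θ : Chars k A) : Prop where
  mem : n ∈ Subgroup.normalizer (A : Set (GroupLike k H))
  eq : ∀ a b : A, (b : GroupLike k H) = n * a * n⁻¹ → χ₁ a * θ b = χ₂ a

lemma Conjugates.exists_right {n : GroupLike k H} {χ₁ χ₂ θ : Chars k A}
    (h : Conjugates n χ₁ χ₂ θ) (a : A) : ∃ b : A, (b : GroupLike k H) = n * a * n⁻¹ :=
  ⟨⟨_, (Subgroup.mem_normalizer_iff.1 h.mem a).1 a.2⟩, rfl⟩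

lemma Conjugates.exists_left {n : GroupLike k H} {χ₁ χ₂ θ : Chars k A}
    (h : Conjugates n χ₁ χ₂ θ) (b : A) : ∃ a : A, (b : GroupLike k H) = n * a * n⁻¹ :=
  ⟨⟨_, (Subgroup.mem_normalizer_iff''.1 h.mem b).1 b.2⟩, by group⟩

/-- Writing $na=bn$ with $b=nan^{-1}$, the condition at $a$ becomes the condition of $C(\theta)$ at
$b$, as $\chi_1(a)\theta(b)=\chi_2(a)$. Since $n$ normalizes $A$, $b$ runs over all of $A$ with $a$.
-/
lemma Conjugates.dualPull_iff {n : GroupLike k H} {χ₁ χ₂ θ : Chars k A}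
    (h : Conjugates n χ₁ χ₂ θ) (α : Dual k H) :
    (∀ (a : A) (t : H), (χ₁ a : k) * dualPull k H n.val α ((a : GroupLike k H).val * t) =
        (χ₂ a : k) * dualPull k H n.val α t) ↔ α ∈ charSpace (H := H) θ := by
  have key : ∀ a b : A, (b : GroupLike k H) = n * a * n⁻¹ →
      ((∀ t : H, (χ₁ a : k) * dualPull k H n.val α ((a : GroupLike k H).val * t) =
        (χ₂ a : k) * dualPull k H n.val α t) ↔
        ∀ t : H, α ((b : GroupLike k H).val * t) = (θ b : k) * α t) := by
    intro a b hb
    have e1 : n.val * (a : GroupLike k H).val = (b : GroupLike k H).val * n.val := by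
      change (n * (a : GroupLike k H)).val = ((b : GroupLike k H) * n).val
      rw [hb]; simp
    have e2 : (χ₂ a : k) = χ₁ a * θ b := by rw [← h.eq a b hb]; simp
    simp only [dualPull_apply, ← mul_assoc, e1, e2]
    simp only [mul_assoc, mul_right_inj' (Units.ne_zero (χ₁ a))]
    constructor
    · intro h t
      have := h (n⁻¹.val * t)
      have e3 : n.val * (n⁻¹.val * t) = t := by
        rw [← mul_assoc]
        change (n * n⁻¹).val * t = t
        rw [mul_inv_cancel]; exact one_mul t
      rwa [e3] at this
    · exact fun h t => h _
  constructor
  · intro hα b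
    obtain ⟨a, hab⟩ := h.exists_left b
    exact (key a b hab).1 (hα a)
  · intro hα a
    obtain ⟨b, hab⟩ := h.exists_right a
    exact (key a b hab).2 (hα b)

lemma dualPull_dualRight (c h : H) (γ : Dual k H) :
    dualPull k H c (dualRight h γ) = dualRight h (dualPull k H c γ) := by
  ext t; simp [dualPull_apply, mul_assoc]

/-- The isomorphism from a stabilizer of one-dimensional `k[A]`-modules to `C(θ)` given by an
element of the normalizer of `A`. -/
noncomputable def stabIso [Module.Finite k H] {n : GroupLike k H} {χ₁ χ₂ θ : Chars k A}
    (h : Conjugates n χ₁ χ₂ θ) :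
    ModIso (stabRep (groupAlgebraComodule A) (charMod χ₁) (charMod χ₂))
      (charRep (H := H) θ) where
  toFun φ := ⟨dualPull k H n⁻¹.val
      (TensorProduct.rid k (Dual k H) (φ.1 ((counit : Dual k H) ⊗ₜ 1))), by
    rw [← h.dualPull_iff, dualPull_val_dualPull_val, inv_mul_cancel, dualPull_val_one,
      ← leftMulMap_mem_stabilizer_iff, eq_leftMulMap_of_mem_range φ.2.2]
    exact φ.2⟩
  map_add' _ _ := Subtype.ext (by simp)
  map_smul' _ _ := Subtype.ext (by simp)
  invFun α := ⟨leftMulMap k H k k (dualPull k H n.val α.1 ⊗ₜ LinearMap.id),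
    (leftMulMap_mem_stabilizer_iff _ _ _).2 ((h.dualPull_iff _).2 α.2)⟩
  left_inv φ := Subtype.ext (by
    simp only [dualPull_val_dualPull_val, inv_mul_cancel, dualPull_val_one]
    exact eq_leftMulMap_of_mem_range φ.2.2)
  right_inv α := Subtype.ext (by
    simp only [leftMulMap_tmul, dualMul_counit, LinearMap.id_apply, TensorProduct.rid_tmul,
      one_smul, dualPull_val_dualPull_val, mul_inv_cancel, dualPull_val_one])
  map_act r φ := Subtype.ext (by
    obtain ⟨φ, hφ⟩ := φ
    have e : homRep k H k k r φ ((counit : Dual k H) ⊗ₜ 1) =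
        LinearMap.rTensor k (dualRight r) (φ ((counit : Dual k H) ⊗ₜ 1)) := by
      rw [← eq_leftMulMap_of_mem_range hφ.2, homRep_leftMulMap]
      simp [leftMulMap_tmul, dualMul_counit]
    change dualPull k H n⁻¹.val (TensorProduct.rid k (Dual k H)
      (homRep k H k k r φ ((counit : Dual k H) ⊗ₜ 1))) =
      dualRight r (dualPull k H n⁻¹.val (TensorProduct.rid k (Dual k H)
        (φ ((counit : Dual k H) ⊗ₜ 1))))
    rw [e, ← dualPull_dualRight]
    congr 1
    generalize φ ((counit : Dual k H) ⊗ₜ 1) = u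
    induction u using TensorProduct.induction_on with
    | zero => simp
    | add x y hx hy => simp only [map_add, hx, hy]
    | tmul b c => simp)

/-- The isomorphisms `stabIso` for a family of elements of the normalizer. -/
noncomputable def groupAlgebraStabIsos [Module.Finite k H] {f : Chars k A → Chars k A}
    {g : Chars k A → Chars k A → GroupLike k H}
    (h : ∀ lam μ, Conjugates (g lam μ) (f lam) (f μ) (lam * μ⁻¹)) :
    StabIsos (groupAlgebraComodule A) (fun lam => charMod (f lam)) where
  iso lam μ := stabIso (h lam μ)
  iso_id lam := by
    change dualPull k H (g lam lam)⁻¹.val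
      (TensorProduct.rid k (Dual k H) ((counit : Dual k H) ⊗ₜ 1)) = counit
    rw [TensorProduct.rid_tmul, one_smul, dualPull_groupLike_counit]

/-- The inverse isomorphism translates $h\mapsto F(S(h)x)$ by $g$; its value at $1$ is $F(S(g)x)$,
and $S(g)=g^{-1}$. -/
lemma groupAlgebraStabIsos_psi [Module.Finite k H] {f : Chars k A → Chars k A}
    {g : Chars k A → Chars k A → GroupLike k H}
    (h : ∀ lam μ, Conjugates (g lam μ) (f lam) (f μ) (lam * μ⁻¹))
    {X : Type*} [AddCommGroup X] [Module k X] (ρ : H →ₐ[k] Module.End k X)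
    (lam ν : Chars k A) (x : X) (hx : x ∈ weightSpace ρ (lam⁻¹ * ν)) (F : Dual k X) (c : k) :
    (groupAlgebraStabIsos h).psi lam ν ρ x hx F c = c * F (ρ (g lam ν)⁻¹.val x) := by
  change TensorProduct.lid k k (LinearMap.rTensor k (LinearMap.applyₗ (1 : H))
    (leftMulMap k H k k (dualPull k H (g lam ν).val (matrixCoeff ρ x F) ⊗ₜ LinearMap.id)
      ((counit : Dual k H) ⊗ₜ c))) = _
  rw [leftMulMap_tmul, dualMul_counit]
  simp [dualPull_apply, matrixCoeff, mul_comm]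

end GroupAlgebraStabilizer

/-! ### The group algebra as a dynamical datum. -/

section GroupAlgebraDatum

variable {k H : Type*} [Field k] [Ring H] [HopfAlgebra k H] {A : Subgroup (GroupLike k H)}

/-- A functional on `H` that is dual to the element `a` of `A`. -/
lemma exists_dual_groupLike (a : A) : ∃ c : Dual k H,
    ∀ b : A, c (b : GroupLike k H).val = (Finsupp.single b (1 : k)) a := by
  classical
  have hli : LinearIndependent k (fun b : A => (b : GroupLike k H).val) :=
    (linearIndep_groupLikeVal (R := k) (A := H)).comp _ Subtype.val_injective
  obtain ⟨c, hc⟩ := (Basis.span hli).constr k (M' := k)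
    (fun b => (Finsupp.single b (1 : k)) a) |>.exists_extend
  refine ⟨c, fun b => ?_⟩
  have h1 := LinearMap.congr_fun hc (Basis.span hli b)
  rw [Basis.constr_basis] at h1
  rw [← h1, LinearMap.comp_apply, Submodule.subtype_apply, Basis.span_apply]

/-- The coaction records the $A$-grading, so contracting it with a functional dual to $a$ extracts
the component at $a$. Both $H$-simplicity and triviality of the coinvariants follow from this. -/
lemma contract_coact {a : A} {c : Dual k H}
    (hc : ∀ b : A, c (b : GroupLike k H).val = (Finsupp.single b (1 : k)) a)
    (x : MonoidAlgebra k A) :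
    TensorProduct.lid k _ (LinearMap.rTensor _ c ((groupAlgebraComodule A).coact x)) =
      x.coeff a • MonoidAlgebra.of k A a := by
  classical
  induction x using MonoidAlgebra.induction_on with
  | of b =>
    have h : (groupAlgebraComodule A).coact (MonoidAlgebra.of k A b) =
        (b : GroupLike k H).val ⊗ₜ MonoidAlgebra.of k A b := by
      simp [groupAlgebraComodule]
    rw [h, LinearMap.rTensor_tmul, TensorProduct.lid_tmul, hc]
    rcases eq_or_ne b a with rfl | hba
    · rfl
    · rw [Finsupp.single_eq_of_ne' hba]
      have h2 : (MonoidAlgebra.of k A b).coeff a = 0 := by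
        simp [MonoidAlgebra.of_apply, Finsupp.single_eq_of_ne' hba]
      rw [h2, zero_smul, zero_smul]
  | add x y hx hy => simp only [map_add, hx, hy, MonoidAlgebra.coeff_add, Finsupp.add_apply, add_smul]
  | smul r x hx => simp only [map_smul, hx, MonoidAlgebra.coeff_smul, Finsupp.smul_apply, smul_assoc]

lemma groupAlgebraComodule_isHSimple : (groupAlgebraComodule A).IsHSimple := by
  refine ⟨inferInstance, fun I hI => ?_⟩
  by_contra! hne
  obtain ⟨x, hxI, hx0⟩ : ∃ x ∈ I, x ≠ 0 := by
    by_contra! h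
    refine hne.1 (le_antisymm (fun x hx => ?_) bot_le)
    rw [h x hx]
    exact zero_mem _
  obtain ⟨a, ha⟩ : ∃ a, x.coeff a ≠ 0 := by
    by_contra! h
    exact hx0 (MonoidAlgebra.ext (Finsupp.ext h))
  obtain ⟨c, hc⟩ := exists_dual_groupLike a
  obtain ⟨z, hz⟩ := hI x hxI
  have h1 := contract_coact hc x
  rw [← hz] at h1
  have h2 : ∀ z, TensorProduct.lid k _ (LinearMap.rTensor _ c
      (LinearMap.lTensor H (I.asIdeal.restrictScalars k).subtype z)) ∈ I := by
    intro z
    have e : TensorProduct.lid k _ (LinearMap.rTensor _ c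
        (LinearMap.lTensor H (I.asIdeal.restrictScalars k).subtype z)) =
        (TensorProduct.lid k _ (LinearMap.rTensor (I.asIdeal.restrictScalars k) c z)).1 := by
      induction z using TensorProduct.induction_on with
      | zero => simp
      | add p q hp hq => simp only [map_add, hp, hq, Submodule.coe_add]
      | tmul p q => simp
    rw [e]
    exact TwoSidedIdeal.mem_asIdeal.1 (TensorProduct.lid k _ (LinearMap.rTensor _ c z)).2
  have h3 := h2 z
  rw [h1] at h3
  refine hne.2 ?_
  rw [← TwoSidedIdeal.one_mem_iff]
  -- The ideal contains a nonzero multiple of $a$, which is a unit.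
  have h4 := I.mul_mem_left ((x.coeff a)⁻¹ • MonoidAlgebra.of k A a⁻¹) _ h3
  rwa [smul_mul_smul_comm, inv_mul_cancel₀ ha, ← map_mul, inv_mul_cancel, map_one, one_smul] at h4

lemma groupAlgebraComodule_hasTrivialCoinvariants :
    (groupAlgebraComodule A).HasTrivialCoinvariants := by
  classical
  intro x
  constructor
  · intro hx
    obtain ⟨c, hc⟩ := exists_dual_groupLike (1 : A)
    have h1 := contract_coact hc x
    have h2 := hc 1
    rw [Finsupp.single_eq_same] at h2
    change c (1 : H) = 1 at h2
    rw [hx, LinearMap.rTensor_tmul, TensorProduct.lid_tmul, h2, one_smul,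
      map_one (MonoidAlgebra.of k A)] at h1
    exact ⟨_, h1.trans (Algebra.algebraMap_eq_smul_one _).symm⟩
  · rintro ⟨r, rfl⟩
    rw [AlgHom.commutes, Algebra.algebraMap_eq_smul_one, Algebra.algebraMap_eq_smul_one,
      TensorProduct.tmul_smul, Algebra.TensorProduct.one_def]

lemma charMod_irreducible (χ : Chars k A) : IsIrreducibleMod (charMod χ) :=
  ⟨inferInstance, fun p _ => eq_bot_or_eq_top (p : Ideal k)⟩

lemma isDynamicalDatum_groupAlgebra [CharZero k] [Module.Finite k H] [Finite A]
    {f : Chars k A → Chars k A} {g : Chars k A → Chars k A → GroupLike k H}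
    (h : ∀ lam μ, Conjugates (g lam μ) (f lam) (f μ) (lam * μ⁻¹)) :
    IsDynamicalDatum (groupAlgebraComodule A) (fun lam => charMod (f lam)) where
  finite := inferInstance
  simple := groupAlgebraComodule_isHSimple
  -- Maschke's theorem, in characteristic $0$.
  semisimple := inferInstance
  coinvariants := groupAlgebraComodule_hasTrivialCoinvariants
  irreducible lam := charMod_irreducible (f lam)
  stab_iso lam μ := ⟨stabIso (h lam μ)⟩

end GroupAlgebraDatum

/-! ### The idempotents of the characters of $A$. -/

section Idempotents

open Coalgebra HopfAlgebra

variable {k H : Type*} [Field k] [Ring H] [HopfAlgebra k H] {A : Subgroup (GroupLike k H)}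

@[ext] lemma Chars.ext {μ ν : Chars k A} (h : ∀ a, μ a = ν a) : μ = ν := DFunLike.ext _ _ h

/-- Regarding $\varepsilon$ as the trivial module lets its values on idempotents be read off from
the general action of idempotents on weight vectors. -/
lemma counit_mem_weightSpace : (1 : k) ∈
    weightSpace (A := A) ((Algebra.lmul k k).comp (Bialgebra.counitAlgHom k H)) 1 := fun a => by
  simp

variable [Fintype A]

lemma val_mul_idem (μ : Chars k A) (a : A) :
    (a : GroupLike k H).val * idem (H := H) μ = (μ a : k) • idem (H := H) μ := by
  rw [idem, mul_smul_comm, Finset.mul_sum, smul_comm (μ a : k)]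
  congr 1
  rw [Finset.smul_sum]
  refine Fintype.sum_equiv (Equiv.mulLeft a) _ _ fun b => ?_
  rw [mul_smul_comm, smul_smul, Equiv.coe_mulLeft, mul_inv_rev, map_mul]
  have : (μ a : k) * ((μ b⁻¹ * μ a⁻¹ : kˣ) : k) = (μ b⁻¹ : k) := by
    rw [mul_comm (μ b⁻¹)]; simp
  rw [this]
  rfl

lemma antipode_idem (μ : Chars k A) :
    antipode k (idem (H := H) μ) = idem (H := H) μ⁻¹ := by
  rw [idem, idem, map_smul, map_sum]
  congr 1
  refine Fintype.sum_equiv (Equiv.inv A) _ _ fun b => ?_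
  rw [map_smul]
  simp

section Modules

variable {X : Type*} [AddCommGroup X] [Module k X]

lemma rep_idem_apply (ρ : H →ₐ[k] Module.End k X) {x : X} {ν : Chars k A}
    (hx : x ∈ weightSpace ρ ν) (μ : Chars k A) :
    ρ (idem μ) x = ((Fintype.card A : k)⁻¹ * ∑ a : A, ((ν * μ⁻¹) a : k)) • x := by
  rw [idem, map_smul, map_sum, LinearMap.smul_apply, LinearMap.sum_apply, mul_smul,
    Finset.sum_smul]
  congr 1
  refine Finset.sum_congr rfl fun a _ => ?_
  rw [map_smul, LinearMap.smul_apply, hx a, smul_smul]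
  simp [mul_comm]

/-- Orthogonality of characters: the values of the nontrivial character $\nu\mu^{-1}$ sum to $0$. -/
lemma rep_idem_of_ne (ρ : H →ₐ[k] Module.End k X) {x : X} {μ ν : Chars k A}
    (hx : x ∈ weightSpace ρ ν) (h : μ ≠ ν) : ρ (idem μ) x = 0 := by
  rw [rep_idem_apply ρ hx]
  have h0 : ∑ a : A, ((ν * μ⁻¹) a : k) = 0 := by
    refine sum_hom_units_eq_zero ((Units.coeHom k).comp ((ν * μ⁻¹ : Chars k A) : A →* kˣ)) ?_
    intro h1
    refine h (mul_inv_eq_one.1 (Chars.ext fun a => Units.ext ?_)).symm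
    exact DFunLike.congr_fun h1 a
  rw [h0, mul_zero, zero_smul]

lemma rep_idem_self [CharZero k] (ρ : H →ₐ[k] Module.End k X) {x : X} {μ : Chars k A}
    (hx : x ∈ weightSpace ρ μ) : ρ (idem μ) x = x := by
  rw [rep_idem_apply ρ hx]
  simp

end Modules

lemma idem_mem_weightSpace (μ : Chars k A) :
    idem (H := H) μ ∈ weightSpace (Algebra.lmul k H) μ := val_mul_idem μ

lemma idem_mul_idem_self [CharZero k] (μ : Chars k A) :
    idem (H := H) μ * idem (H := H) μ = idem (H := H) μ :=
  rep_idem_self (Algebra.lmul k H) (idem_mem_weightSpace μ)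

lemma idem_mul_idem_of_ne {μ ν : Chars k A} (h : μ ≠ ν) :
    idem (H := H) μ * idem (H := H) ν = 0 :=
  rep_idem_of_ne (Algebra.lmul k H) (idem_mem_weightSpace ν) h

lemma counit_idem_one [CharZero k] : counit (R := k) (idem (H := H) (1 : Chars k A)) = 1 := by
  simpa using rep_idem_self _ (counit_mem_weightSpace (A := A))

lemma counit_idem_of_ne {μ : Chars k A} (h : μ ≠ 1) :
    counit (R := k) (idem (H := H) μ) = 0 := by
  simpa using rep_idem_of_ne _ (counit_mem_weightSpace (A := A)) h

/-- Dual orthogonality: $\Bbbk$ has enough roots of unity for characters to separate the points of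
$A$, so only the term at $a=1$ survives, and it is $1$ because $|\widehat A|=|A|$. -/
lemma sum_idem [IsAlgClosed k] [CharZero k] [IsMulCommutative A] :
    ∑ μ : Chars k A, idem (H := H) μ = 1 := by
  let _ : CommGroup A := { (inferInstance : Group A) with
    mul_comm := IsMulCommutative.is_comm.comm }
  have hne : NeZero (Monoid.exponent A : k) := ⟨by
    exact_mod_cast Monoid.exponent_ne_zero_of_finite⟩
  have hcard : Fintype.card (Chars k A) = Fintype.card A := by
    rw [← Nat.card_eq_fintype_card, ← Nat.card_eq_fintype_card]
    exact CommGroup.card_monoidHom_of_hasEnoughRootsOfUnity A k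
  have hsum : ∀ a : A, a ≠ 1 → ∑ μ : Chars k A, (μ a⁻¹ : k) = 0 := by
    intro a ha
    obtain ⟨φ, hφ⟩ := CommGroup.exists_apply_ne_one_of_hasEnoughRootsOfUnity A k (inv_ne_one.2 ha)
    let e : Chars k A →* k :=
      { toFun := fun μ => (μ a⁻¹ : k), map_one' := by simp, map_mul' := fun _ _ => by simp }
    refine sum_hom_units_eq_zero e fun h1 => hφ (Units.ext ?_)
    exact DFunLike.congr_fun h1 (φ : Chars k A)
  simp only [idem]
  rw [← Finset.smul_sum, Finset.sum_comm]
  simp only [← Finset.sum_smul]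
  rw [Finset.sum_eq_single 1 (fun a _ ha => by rw [hsum a ha, zero_smul]) (by simp)]
  simp [hcard]

end Idempotents

/-! ### The normalizer acting on characters and weights. -/

section Conjugation

variable {k H : Type*} [Field k] [Ring H] [HopfAlgebra k H] {A : Subgroup (GroupLike k H)}

/-- The action `μ ↦ μ(n⁻¹ · n)` of the normalizer of `A` on the characters of `A`. -/
def conjChar (n : Subgroup.normalizer (A : Set (GroupLike k H))) : Chars k A →* Chars k A where
  toFun μ := (μ : A →* kˣ).comp (A.normalizerMonoidHom n⁻¹).toMonoidHom
  map_one' := rfl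
  map_mul' _ _ := rfl

lemma conjChar_apply (n : Subgroup.normalizer (A : Set (GroupLike k H))) (μ : Chars k A) (a : A) :
    conjChar n μ a = μ (A.normalizerMonoidHom n⁻¹ a) := rfl

lemma conjChar_mul (m n : Subgroup.normalizer (A : Set (GroupLike k H))) (μ : Chars k A) :
    conjChar (m * n) μ = conjChar m (conjChar n μ) := by
  ext a
  simp [conjChar_apply]

lemma conjChar_one (μ : Chars k A) : conjChar 1 μ = μ := by
  ext a
  simp [conjChar_apply]

lemma conjChar_inv_conjChar (n : Subgroup.normalizer (A : Set (GroupLike k H))) (μ : Chars k A) :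
    conjChar n⁻¹ (conjChar n μ) = μ := by
  rw [← conjChar_mul, inv_mul_cancel, conjChar_one]

lemma conjChar_injective (n : Subgroup.normalizer (A : Set (GroupLike k H))) :
    Function.Injective (conjChar (k := k) n) :=
  Function.LeftInverse.injective (conjChar_inv_conjChar n)

lemma val_mul_val_normalizer (n : Subgroup.normalizer (A : Set (GroupLike k H))) (a : A) :
    (a : GroupLike k H).val * n.1.val =
      n.1.val * (A.normalizerMonoidHom n⁻¹ a : GroupLike k H).val := by
  change ((a : GroupLike k H) * n.1).val = (n.1 * (A.normalizerMonoidHom n⁻¹ a)).val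
  congr 1
  simp [mul_assoc]

/-- Since $an=n(n^{-1}an)$, an element of the normalizer permutes the weight spaces through
`conjChar`. -/
lemma rep_val_mem_weightSpace {X : Type*} [AddCommGroup X] [Module k X]
    (ρ : H →ₐ[k] Module.End k X) (n : Subgroup.normalizer (A : Set (GroupLike k H)))
    {μ : Chars k A} {x : X} (hx : x ∈ weightSpace ρ μ) :
    ρ n.1.val x ∈ weightSpace ρ (conjChar n μ) := fun a => by
  rw [← Module.End.mul_apply, ← map_mul, val_mul_val_normalizer, map_mul, Module.End.mul_apply,
    hx, map_smul]
  rfl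

lemma tmul_mem_weightSpace {X Y : Type*} [AddCommGroup X] [Module k X] [AddCommGroup Y]
    [Module k Y] {ρX : H →ₐ[k] Module.End k X} {ρY : H →ₐ[k] Module.End k Y} {μ ν : Chars k A}
    {x : X} {y : Y} (hx : x ∈ weightSpace ρX μ) (hy : y ∈ weightSpace ρY ν) :
    x ⊗ₜ y ∈ weightSpace (tensorRep ρX ρY) (μ * ν) := fun a => by
  have h : tensorRep ρX ρY (a : GroupLike k H).val (x ⊗ₜ y) =
      ρX (a : GroupLike k H).val x ⊗ₜ ρY (a : GroupLike k H).val y := by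
    simp [tensorRep, outerRep]
    rfl
  rw [h, hx a, hy a, TensorProduct.smul_tmul_smul]
  simp

lemma normalizer_conj_idem [Fintype A] (n : Subgroup.normalizer (A : Set (GroupLike k H)))
    (μ : Chars k A) :
    n.1.val * idem (H := H) μ * n⁻¹.1.val = idem (H := H) (conjChar n μ) := by
  rw [idem, idem, mul_smul_comm, smul_mul_assoc, Finset.mul_sum, Finset.sum_mul]
  congr 1
  refine Fintype.sum_equiv (A.normalizerMonoidHom n).toEquiv _ _ fun a => ?_
  rw [mul_smul_comm, smul_mul_assoc, conjChar_apply]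
  congr 1
  simp

end Conjugation

/-! ### Elements of $H\otimes H$ with group-like coefficients on weight idempotents. -/

section WeightSums

open Coalgebra HopfAlgebra

variable {k H : Type*} [Field k] [Ring H] [HopfAlgebra k H] {A : Subgroup (GroupLike k H)}
  [Fintype A]

/-- The element `∑ m(μ, η) P_μ ⊗ n(μ, η) P_η` of `H ⊗ H`. -/
noncomputable def weightSum (m n : Chars k A → Chars k A → GroupLike k H) : H ⊗[k] H :=
  ∑ μ : Chars k A, ∑ η : Chars k A,
    ((m μ η).val * idem μ) ⊗ₜ[k] ((n μ η).val * idem η)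

/-- The element `∑ P_μ m(μ, η)⁻¹ ⊗ P_η n(μ, η)⁻¹` of `H ⊗ H`. -/
noncomputable def weightSumInv (m n : Chars k A → Chars k A → GroupLike k H) : H ⊗[k] H :=
  ∑ μ : Chars k A, ∑ η : Chars k A,
    (idem μ * (m μ η)⁻¹.val) ⊗ₜ[k] (idem η * (n μ η)⁻¹.val)

lemma outerRep_weightSum_tmul [CharZero k] {X Y : Type*} [AddCommGroup X] [Module k X]
    [AddCommGroup Y] [Module k Y] (ρX : H →ₐ[k] Module.End k X) (ρY : H →ₐ[k] Module.End k Y)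
    (m n : Chars k A → Chars k A → GroupLike k H) {μ η : Chars k A} {x : X} {y : Y}
    (hx : x ∈ weightSpace ρX μ) (hy : y ∈ weightSpace ρY η) :
    outerRep ρX ρY (weightSum m n) (x ⊗ₜ y) = ρX (m μ η).val x ⊗ₜ ρY (n μ η).val y := by
  have h : ∀ a b : H, outerRep ρX ρY (a ⊗ₜ b) (x ⊗ₜ y) = ρX a x ⊗ₜ ρY b y := fun _ _ => rfl
  simp only [weightSum, map_sum, LinearMap.sum_apply, h, map_mul, Module.End.mul_apply]
  rw [Finset.sum_eq_single μ, Finset.sum_eq_single η, rep_idem_self ρX hx, rep_idem_self ρY hy]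
  · intro τ _ hτ
    rw [rep_idem_of_ne ρY hy hτ, map_zero, TensorProduct.tmul_zero]
  · simp
  · intro τ _ hτ
    simp [rep_idem_of_ne ρX hx hτ]
  · simp

/-- Only the term with the weights of $u$ and $v$ survives. The algebra maps are kept general so
that one of them can be $\Delta$ in the cocycle equation. -/
lemma map_weightSum_mul_tmul [CharZero k] {B C : Type*} [Ring B] [Algebra k B] [Ring C]
    [Algebra k C] (φ : H →ₐ[k] B) (ψ : H →ₐ[k] C)
    (m n : Chars k A → Chars k A → GroupLike k H) {μ η : Chars k A} {u : B} {v : C}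
    (hu : u ∈ weightSpace ((Algebra.lmul k B).comp φ) μ)
    (hv : v ∈ weightSpace ((Algebra.lmul k C).comp ψ) η) :
    Algebra.TensorProduct.map φ ψ (weightSum m n) * (u ⊗ₜ v) =
      (φ (m μ η).val * u) ⊗ₜ (ψ (n μ η).val * v) := by
  have h := outerRep_weightSum_tmul _ _ m n hu hv
  have gen : ∀ w : H ⊗[k] H, Algebra.TensorProduct.map φ ψ w * (u ⊗ₜ v) =
      outerRep ((Algebra.lmul k B).comp φ) ((Algebra.lmul k C).comp ψ) w (u ⊗ₜ v) := by
    intro w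
    induction w using TensorProduct.induction_on with
    | zero => simp
    | add x y hx hy => simp only [map_add, add_mul, LinearMap.add_apply, hx, hy]
    | tmul a b =>
      rw [Algebra.TensorProduct.map_tmul, Algebra.TensorProduct.tmul_mul_tmul]
      rfl
  rw [gen, h]
  rfl

lemma weightSum_mul_idem_tmul_idem [CharZero k] (m n : Chars k A → Chars k A → GroupLike k H)
    (μ η : Chars k A) :
    weightSum m n * (idem μ ⊗ₜ idem η) =
      ((m μ η).val * idem μ) ⊗ₜ ((n μ η).val * idem η) := by
  have h := map_weightSum_mul_tmul (AlgHom.id k H) (AlgHom.id k H) m n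
    (u := idem μ) (v := idem η) (idem_mem_weightSpace μ) (idem_mem_weightSpace η)
  simpa using h

lemma ext_idem_tmul_idem [IsAlgClosed k] [CharZero k] [IsMulCommutative A] {u v : H ⊗[k] H}
    (h : ∀ μ η : Chars k A, u * (idem μ ⊗ₜ idem η) = v * (idem μ ⊗ₜ idem η)) : u = v := by
  have h1 : ∑ μ : Chars k A, ∑ η : Chars k A, idem (H := H) μ ⊗ₜ[k] idem (H := H) η = 1 := by
    simp only [← TensorProduct.tmul_sum, ← TensorProduct.sum_tmul, sum_idem,
      Algebra.TensorProduct.one_def]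
  rw [← mul_one u, ← mul_one v, ← h1]
  simp only [Finset.mul_sum, h]

lemma ext_idem_tmul_idem_tmul_idem [IsAlgClosed k] [CharZero k] [IsMulCommutative A]
    {u v : H ⊗[k] (H ⊗[k] H)}
    (h : ∀ μ η τ : Chars k A, u * (idem μ ⊗ₜ (idem η ⊗ₜ idem τ)) =
      v * (idem μ ⊗ₜ (idem η ⊗ₜ idem τ))) : u = v := by
  have h1 : ∑ μ : Chars k A, ∑ η : Chars k A, ∑ τ : Chars k A,
      idem (H := H) μ ⊗ₜ[k] (idem (H := H) η ⊗ₜ[k] idem (H := H) τ) = 1 := by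
    simp only [← TensorProduct.tmul_sum, ← TensorProduct.sum_tmul, sum_idem,
      Algebra.TensorProduct.one_def]
  rw [← mul_one u, ← mul_one v, ← h1]
  simp only [Finset.mul_sum, h]

/-- Each product is $mP_\mu m^{-1}\otimes nP_\eta n^{-1}$, a tensor of idempotents at the conjugated
characters. An injective map of the finite set of pairs is a permutation, so these add up to $1$. -/
lemma weightSum_mul_weightSumInv [IsAlgClosed k] [CharZero k] [IsMulCommutative A]
    (m n : Chars k A → Chars k A → Subgroup.normalizer (A : Set (GroupLike k H)))
    (hinj : Function.Injective fun p : Chars k A × Chars k A =>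
      (conjChar (m p.1 p.2) p.1, conjChar (n p.1 p.2) p.2)) :
    weightSum (fun μ η => (m μ η).1) (fun μ η => (n μ η).1) *
      weightSumInv (fun μ η => (m μ η).1) (fun μ η => (n μ η).1) = 1 := by
  have h1 : ∀ μ η, weightSum (fun μ η => (m μ η).1) (fun μ η => (n μ η).1) *
      ((idem μ * (m μ η).1⁻¹.val) ⊗ₜ[k] (idem η * (n μ η).1⁻¹.val)) =
      idem (H := H) (conjChar (m μ η) μ) ⊗ₜ idem (H := H) (conjChar (n μ η) η) := by
    intro μ η
    rw [← Algebra.TensorProduct.tmul_mul_tmul, ← mul_assoc, weightSum_mul_idem_tmul_idem,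
      Algebra.TensorProduct.tmul_mul_tmul, ← normalizer_conj_idem, ← normalizer_conj_idem]
    rfl
  simp only [weightSumInv, Finset.mul_sum, h1]
  rw [← Fintype.sum_prod_type' (fun μ η => idem (H := H) (conjChar (m μ η) μ) ⊗ₜ[k]
    idem (H := H) (conjChar (n μ η) η))]
  rw [Fintype.sum_bijective _ (Finite.injective_iff_bijective.1 hinj) _
    (fun p : Chars k A × Chars k A => idem (H := H) p.1 ⊗ₜ[k] idem (H := H) p.2)
    (fun _ => rfl), Fintype.sum_prod_type]
  simp only [← TensorProduct.tmul_sum, ← TensorProduct.sum_tmul, sum_idem,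
    Algebra.TensorProduct.one_def]

/-- The unit of `H ⊗ H` given by `weightSum`. -/
noncomputable def weightUnit [IsAlgClosed k] [CharZero k] [IsMulCommutative A] [Module.Finite k H]
    (m n : Chars k A → Chars k A → Subgroup.normalizer (A : Set (GroupLike k H)))
    (hinj : Function.Injective fun p : Chars k A × Chars k A =>
      (conjChar (m p.1 p.2) p.1, conjChar (n p.1 p.2) p.2)) : (H ⊗[k] H)ˣ where
  val := weightSum (fun μ η => (m μ η).1) (fun μ η => (n μ η).1)
  inv := weightSumInv (fun μ η => (m μ η).1) (fun μ η => (n μ η).1)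
  val_inv := weightSum_mul_weightSumInv m n hinj
  inv_val := by
    -- In a finite-dimensional algebra a one-sided inverse is two-sided.
    have : IsArtinianRing (H ⊗[k] H) := IsArtinianRing.of_finite k _
    exact mul_eq_one_symm (weightSum_mul_weightSumInv m n hinj)

lemma antipodeInv_idem_mul_val [Module.Finite k H] (μ : Chars k A) (n : GroupLike k H) :
    antipodeInv k H (idem μ * n⁻¹.val) = n.val * idem μ⁻¹ := by
  rw [← antipodeInv_antipode (k := k) (n.val * idem (H := H) μ⁻¹), antipode_mul_antidistrib,
    antipode_idem, inv_inv]
  rfl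

/-- $S^{-1}$ reverses products, inverts group-likes and sends $P_\mu$ to $P_{\mu^{-1}}$; reindexing
by inverses, together with the flip, gives the swapped arguments. -/
lemma map_antipodeInv_comm_weightSumInv [Module.Finite k H]
    (m n : Chars k A → Chars k A → GroupLike k H) :
    TensorProduct.map (antipodeInv k H) (antipodeInv k H)
      (TensorProduct.comm k H H (weightSumInv m n)) =
      weightSum (fun μ η => n η⁻¹ μ⁻¹) (fun μ η => m η⁻¹ μ⁻¹) := by
  simp only [weightSumInv, weightSum, map_sum, TensorProduct.comm_tmul, TensorProduct.map_tmul,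
    antipodeInv_idem_mul_val]
  rw [Finset.sum_comm]
  refine Fintype.sum_equiv (Equiv.inv _) _ _ fun η => ?_
  refine Fintype.sum_equiv (Equiv.inv _) _ _ fun μ => ?_
  simp

/-- The counit kills every $P_\mu$ with $\mu\neq1$, leaving $\sum_\eta n(1,\eta)P_\eta$. -/
lemma lid_rTensor_counit_weightSum [IsAlgClosed k] [CharZero k] [IsMulCommutative A]
    (m n : Chars k A → Chars k A → GroupLike k H) (hn : ∀ η, n 1 η = 1) :
    TensorProduct.lid k H (LinearMap.rTensor H (counit (R := k) (A := H)) (weightSum m n)) = 1 := by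
  simp only [weightSum, map_sum, LinearMap.rTensor_tmul, TensorProduct.lid_tmul,
    Bialgebra.counit_mul, GroupLike.isGroupLikeElem_val, IsGroupLikeElem.counit_eq_one, one_mul]
  rw [Finset.sum_eq_single 1 (fun μ _ hμ => by simp [counit_idem_of_ne hμ]) (by simp)]
  simp only [counit_idem_one, one_smul, hn, GroupLike.val_one, one_mul, sum_idem]

lemma rid_lTensor_counit_weightSum [IsAlgClosed k] [CharZero k] [IsMulCommutative A]
    (m n : Chars k A → Chars k A → GroupLike k H) (hm : ∀ μ, m μ 1 = 1) :
    TensorProduct.rid k H (LinearMap.lTensor H (counit (R := k) (A := H)) (weightSum m n)) = 1 := by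
  simp only [weightSum, map_sum, LinearMap.lTensor_tmul, TensorProduct.rid_tmul,
    Bialgebra.counit_mul, GroupLike.isGroupLikeElem_val, IsGroupLikeElem.counit_eq_one, one_mul]
  rw [Finset.sum_comm,
    Finset.sum_eq_single 1 (fun η _ hη => by simp [counit_idem_of_ne hη]) (by simp)]
  simp only [counit_idem_one, one_smul, hm, GroupLike.val_one, one_mul, sum_idem]

end WeightSums

/-! ### The exchange matrix and the twist built from $g$. -/

section GroupTwist

open Coalgebra HopfAlgebra

variable {k : Type*} {H : Type w} [Field k] [Ring H] [HopfAlgebra k H]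
  {A : Subgroup (GroupLike k H)}

lemma tmul_mem_weightSpace_comul {μ ν : Chars k A} {x y : H}
    (hx : x ∈ weightSpace (Algebra.lmul k H) μ) (hy : y ∈ weightSpace (Algebra.lmul k H) ν) :
    x ⊗ₜ y ∈ weightSpace ((Algebra.lmul k (H ⊗[k] H)).comp (Bialgebra.comulAlgHom k H))
      (μ * ν) := fun a => by
  have hx : (a : GroupLike k H).val * x = (μ a : k) • x := hx a
  have hy : (a : GroupLike k H).val * y = (ν a : k) • y := hy a
  simp [hx, hy, ← TensorProduct.smul_tmul', smul_smul, mul_comm]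

variable (G : Chars k A → Chars k A → Subgroup.normalizer (A : Set (GroupLike k H)))

/-- The left coefficients of the exchange matrix. -/
def exchangeLeft (lam μ η : Chars k A) : Subgroup.normalizer (A : Set (GroupLike k H)) :=
  G lam (lam * μ * η) * (G lam (lam * μ))⁻¹

/-- The right coefficients of the exchange matrix. -/
def exchangeRight (lam μ η : Chars k A) : Subgroup.normalizer (A : Set (GroupLike k H)) :=
  G lam (lam * μ * η) * (G (lam * μ) (lam * μ * η))⁻¹

/-- The left coefficients of the twist. -/
def twistLeft (lam μ η : Chars k A) : Subgroup.normalizer (A : Set (GroupLike k H)) :=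
  G lam (lam * μ⁻¹ * η⁻¹) * (G (lam * η⁻¹) (lam * μ⁻¹ * η⁻¹))⁻¹

/-- The right coefficients of the twist. -/
def twistRight (lam μ η : Chars k A) : Subgroup.normalizer (A : Set (GroupLike k H)) :=
  G lam (lam * μ⁻¹ * η⁻¹) * (G lam (lam * η⁻¹))⁻¹

variable {G} {f : Equiv.Perm (Chars k A)}

lemma conjChar_inv_of_conj (hG : ∀ lam μ, conjChar (G lam μ) (f lam * (f μ)⁻¹) = μ * lam⁻¹)
    {lam μ ν : Chars k A} (h : μ * lam⁻¹ = ν) :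
    conjChar (G lam μ)⁻¹ ν = f lam * (f μ)⁻¹ := by
  rw [← h, ← hG, conjChar_inv_conjChar]

lemma conjChar_exchangeLeft
    (hG : ∀ lam μ, conjChar (G lam μ) (f lam * (f μ)⁻¹) = μ * lam⁻¹) (lam μ η : Chars k A) :
    conjChar (exchangeLeft G lam μ η) μ =
      conjChar (G lam (lam * μ * η)) (f lam * (f (lam * μ))⁻¹) := by
  rw [exchangeLeft, conjChar_mul, conjChar_inv_of_conj hG (by rw [mul_right_comm]; simp)]

lemma conjChar_exchangeRight
    (hG : ∀ lam μ, conjChar (G lam μ) (f lam * (f μ)⁻¹) = μ * lam⁻¹) (lam μ η : Chars k A) :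
    conjChar (exchangeRight G lam μ η) η =
      conjChar (G lam (lam * μ * η)) (f (lam * μ) * (f (lam * μ * η))⁻¹) := by
  rw [exchangeRight, conjChar_mul, conjChar_inv_of_conj hG (by rw [mul_right_comm]; simp)]

/-- Before the common conjugation by $g(\lambda,\lambda\mu\eta)$ the two weights are
$f(\lambda)f(\lambda\mu)^{-1}$ and $f(\lambda\mu)f(\lambda\mu\eta)^{-1}$. Their product telescopes.
-/
lemma conjChar_exchange_mul
    (hG : ∀ lam μ, conjChar (G lam μ) (f lam * (f μ)⁻¹) = μ * lam⁻¹) (lam μ η : Chars k A) :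
    conjChar (exchangeLeft G lam μ η) μ * conjChar (exchangeRight G lam μ η) η = μ * η := by
  rw [conjChar_exchangeLeft hG, conjChar_exchangeRight hG, ← map_mul, mul_assoc (f lam),
    inv_mul_cancel_left, hG, mul_assoc lam,
    mul_inv_cancel_comm]

lemma exchange_injective
    (hG : ∀ lam μ, conjChar (G lam μ) (f lam * (f μ)⁻¹) = μ * lam⁻¹) (lam : Chars k A) :
    Function.Injective fun p : Chars k A × Chars k A =>
      (conjChar (exchangeLeft G lam p.1 p.2) p.1, conjChar (exchangeRight G lam p.1 p.2) p.2) := by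
  rintro ⟨μ, η⟩ ⟨μ', η'⟩ h
  obtain ⟨h1, h2⟩ := Prod.ext_iff.1 h
  simp only at h1 h2
  have h3 : μ * η = μ' * η' := by
    rw [← conjChar_exchange_mul hG lam μ η, ← conjChar_exchange_mul hG lam μ' η', h1, h2]
  rw [conjChar_exchangeLeft hG, conjChar_exchangeLeft hG, mul_assoc lam, mul_assoc lam, h3] at h1
  -- With equal products $\mu\eta$ the conjugating elements agree, so
  -- $f(\lambda\mu)=f(\lambda\mu')$; this is where injectivity of $f$ enters.
  have h4 : μ = μ' := by
    simpa using conjChar_injective _ h1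
  subst h4
  simpa using h3

lemma conjChar_twistLeft
    (hG : ∀ lam μ, conjChar (G lam μ) (f lam * (f μ)⁻¹) = μ * lam⁻¹) (lam μ η : Chars k A) :
    conjChar (twistLeft G lam μ η) μ =
      conjChar (G lam (lam * μ⁻¹ * η⁻¹)) (f (lam * μ⁻¹ * η⁻¹) * (f (lam * η⁻¹))⁻¹) := by
  have h : conjChar (G (lam * η⁻¹) (lam * μ⁻¹ * η⁻¹))⁻¹ μ⁻¹ =
      f (lam * η⁻¹) * (f (lam * μ⁻¹ * η⁻¹))⁻¹ :=
    conjChar_inv_of_conj hG (by rw [mul_right_comm, mul_right_comm lam]; simp)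
  rw [map_inv, inv_eq_iff_eq_inv] at h
  rw [twistLeft, conjChar_mul, h]
  simp

lemma conjChar_twistRight
    (hG : ∀ lam μ, conjChar (G lam μ) (f lam * (f μ)⁻¹) = μ * lam⁻¹) (lam μ η : Chars k A) :
    conjChar (twistRight G lam μ η) η =
      conjChar (G lam (lam * μ⁻¹ * η⁻¹)) (f (lam * η⁻¹) * (f lam)⁻¹) := by
  have h : conjChar (G lam (lam * η⁻¹))⁻¹ η⁻¹ = f lam * (f (lam * η⁻¹))⁻¹ :=
    conjChar_inv_of_conj hG (by rw [mul_right_comm]; simp)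
  rw [map_inv, inv_eq_iff_eq_inv] at h
  rw [twistRight, conjChar_mul, h]
  simp

lemma conjChar_twist_mul
    (hG : ∀ lam μ, conjChar (G lam μ) (f lam * (f μ)⁻¹) = μ * lam⁻¹) (lam μ η : Chars k A) :
    conjChar (twistLeft G lam μ η) μ * conjChar (twistRight G lam μ η) η = μ * η := by
  rw [conjChar_twistLeft hG, conjChar_twistRight hG, ← map_mul, mul_assoc (f _),
    inv_mul_cancel_left, ← inv_inj, ← map_inv, mul_inv_rev, inv_inv, hG, mul_assoc lam,
    mul_inv_cancel_comm, mul_inv]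

/-- As for the exchange matrix, with the roles of the two factors exchanged: the intermediate point
is now $\lambda\eta^{-1}$, so $\eta$ is recovered first. -/
lemma twist_injective
    (hG : ∀ lam μ, conjChar (G lam μ) (f lam * (f μ)⁻¹) = μ * lam⁻¹) (lam : Chars k A) :
    Function.Injective fun p : Chars k A × Chars k A =>
      (conjChar (twistLeft G lam p.1 p.2) p.1, conjChar (twistRight G lam p.1 p.2) p.2) := by
  rintro ⟨μ, η⟩ ⟨μ', η'⟩ h
  obtain ⟨h1, h2⟩ := Prod.ext_iff.1 h
  simp only at h1 h2
  have h3 : μ * η = μ' * η' := by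
    rw [← conjChar_twist_mul hG lam μ η, ← conjChar_twist_mul hG lam μ' η', h1, h2]
  rw [conjChar_twistRight hG, conjChar_twistRight hG, mul_assoc lam, mul_assoc lam, ← mul_inv,
    ← mul_inv, h3] at h2
  have h4 : η = η' := by
    simpa using conjChar_injective _ h2
  subst h4
  simpa using h3

variable [Fintype A]

variable (G) in
/-- The element `∑ g(λ, λμ⁻¹η⁻¹) g(λη⁻¹, λμ⁻¹η⁻¹)⁻¹ P_μ ⊗ g(λ, λμ⁻¹η⁻¹) g(λ, λη⁻¹)⁻¹ P_η`. -/
noncomputable def groupTwist (lam : Chars k A) : H ⊗[k] H :=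
  weightSum (fun μ η => (twistLeft G lam μ η).1) (fun μ η => (twistRight G lam μ η).1)

variable [CharZero k]

/-- Preservation of the total weight under $\Delta$. Invariance under $a\otimes a$ follows from it,
and in the cocycle equation it determines the coefficient to use after $\Delta$ is applied to one
factor. -/
lemma groupTwist_mul_idem_mem_weightSpace
    (hG : ∀ lam μ, conjChar (G lam μ) (f lam * (f μ)⁻¹) = μ * lam⁻¹) (lam μ η : Chars k A) :
    groupTwist G lam * (idem μ ⊗ₜ idem η) ∈
      weightSpace ((Algebra.lmul k (H ⊗[k] H)).comp (Bialgebra.comulAlgHom k H)) (μ * η) := by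
  rw [groupTwist, weightSum_mul_idem_tmul_idem, ← conjChar_twist_mul hG lam μ η]
  exact tmul_mem_weightSpace_comul
    (rep_val_mem_weightSpace (Algebra.lmul k H) _ (idem_mem_weightSpace μ))
    (rep_val_mem_weightSpace (Algebra.lmul k H) _ (idem_mem_weightSpace η))

variable [IsAlgClosed k] [IsMulCommutative A]

lemma groupTwist_comm
    (hG : ∀ lam μ, conjChar (G lam μ) (f lam * (f μ)⁻¹) = μ * lam⁻¹) (lam : Chars k A) (a : A) :
    groupTwist G lam * ((a : GroupLike k H).val ⊗ₜ (a : GroupLike k H).val) =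
      ((a : GroupLike k H).val ⊗ₜ (a : GroupLike k H).val) * groupTwist G lam := by
  refine ext_idem_tmul_idem (A := A) fun μ η => ?_
  have h := groupTwist_mul_idem_mem_weightSpace hG lam μ η a
  change Bialgebra.comulAlgHom k H (a : GroupLike k H).val * _ = _ at h
  rw [Bialgebra.comulAlgHom_apply,
    (a : GroupLike k H).isGroupLikeElem_val.comul_eq_tmul_self] at h
  rw [mul_assoc, mul_assoc, h, Algebra.TensorProduct.tmul_mul_tmul, val_mul_idem, val_mul_idem,
    TensorProduct.smul_tmul_smul, mul_smul_comm]
  simp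

lemma groupTwist_cocycle
    (hG : ∀ lam μ, conjChar (G lam μ) (f lam * (f μ)⁻¹) = μ * lam⁻¹) (lam : Chars k A) :
    Algebra.TensorProduct.assoc k k k H H H
      (∑ μ : Chars k A,
        Algebra.TensorProduct.map (Bialgebra.comulAlgHom k H) (AlgHom.id k H) (groupTwist G lam) *
          (groupTwist G (lam * μ⁻¹) ⊗ₜ[k] idem (H := H) μ)) =
      Algebra.TensorProduct.map (AlgHom.id k H) (Bialgebra.comulAlgHom k H) (groupTwist G lam) *
        (1 ⊗ₜ[k] groupTwist G lam) := by
  refine ext_idem_tmul_idem_tmul_idem (A := A) fun α β γ => ?_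
  have e0 : (idem (H := H) α ⊗ₜ[k] (idem (H := H) β ⊗ₜ[k] idem (H := H) γ)) =
      Algebra.TensorProduct.assoc k k k H H H ((idem α ⊗ₜ[k] idem β) ⊗ₜ[k] idem γ) := by simp
  -- Multiplication by $P_\gamma$ in the third factor selects the term $\mu=\gamma$, fixing the
  -- shifted parameter $\lambda\gamma^{-1}$.
  have e1 : (∑ μ : Chars k A,
        Algebra.TensorProduct.map (Bialgebra.comulAlgHom k H) (AlgHom.id k H) (groupTwist G lam) *
          (groupTwist G (lam * μ⁻¹) ⊗ₜ[k] idem (H := H) μ)) *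
        ((idem α ⊗ₜ[k] idem β) ⊗ₜ[k] idem γ) =
      Algebra.TensorProduct.map (Bialgebra.comulAlgHom k H) (AlgHom.id k H) (groupTwist G lam) *
        ((groupTwist G (lam * γ⁻¹) * (idem α ⊗ₜ[k] idem β)) ⊗ₜ[k] idem (H := H) γ) := by
    rw [Finset.sum_mul, Finset.sum_eq_single γ]
    · rw [mul_assoc, Algebra.TensorProduct.tmul_mul_tmul, idem_mul_idem_self]
    · intro μ _ hμ
      rw [mul_assoc, Algebra.TensorProduct.tmul_mul_tmul, idem_mul_idem_of_ne hμ]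
      simp
    · simp
  have c1 : lam * (α * β)⁻¹ * γ⁻¹ = lam * γ⁻¹ * α⁻¹ * β⁻¹ := by
    rw [mul_inv, mul_right_comm, ← mul_assoc]
  have c2 : lam * α⁻¹ * (β * γ)⁻¹ = lam * γ⁻¹ * α⁻¹ * β⁻¹ := by
    rw [mul_inv, mul_comm β⁻¹, ← mul_assoc, mul_right_comm lam]
  have c3 : lam * (β * γ)⁻¹ = lam * γ⁻¹ * β⁻¹ := by
    rw [mul_inv, mul_comm β⁻¹, ← mul_assoc]
  have c4 : lam * β⁻¹ * γ⁻¹ = lam * γ⁻¹ * β⁻¹ := mul_right_comm _ _ _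
  -- The cocycle equation, one tensor factor at a time: `n1`, `n2` and `n3` compare the group-like
  -- coefficients of $P_\alpha$, $P_\beta$ and $P_\gamma$, and in each the inner values of $g$
  -- cancel.
  have n1 : twistLeft G lam (α * β) γ * twistLeft G (lam * γ⁻¹) α β =
      twistLeft G lam α (β * γ) := by
    simp only [twistLeft, c1, c2, c3]; group
  have n2 : twistLeft G lam (α * β) γ * twistRight G (lam * γ⁻¹) α β =
      twistRight G lam α (β * γ) * twistLeft G lam β γ := by
    simp only [twistLeft, twistRight, c1, c2, c3, c4]; group
  have n3 : twistRight G lam (α * β) γ =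
      twistRight G lam α (β * γ) * twistRight G lam β γ := by
    simp only [twistRight, c1, c2, c3, c4]; group
  have hcomul : ∀ (n : Subgroup.normalizer (A : Set (GroupLike k H))),
      Bialgebra.comulAlgHom k H n.1.val = n.1.val ⊗ₜ n.1.val :=
    fun n => n.1.isGroupLikeElem_val.comul_eq_tmul_self
  have hval : ∀ (m n : Subgroup.normalizer (A : Set (GroupLike k H))) (x : H),
      m.1.val * (n.1.val * x) = (m * n).1.val * x := fun m n x => (mul_assoc _ _ _).symm
  rw [e0, ← map_mul, e1, ← e0, mul_assoc, Algebra.TensorProduct.tmul_mul_tmul, one_mul]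
  have l := map_weightSum_mul_tmul (Bialgebra.comulAlgHom k H) (AlgHom.id k H)
    (fun μ η => (twistLeft G lam μ η).1) (fun μ η => (twistRight G lam μ η).1)
    (groupTwist_mul_idem_mem_weightSpace hG (lam * γ⁻¹) α β)
    (v := idem γ) (idem_mem_weightSpace γ)
  have r := map_weightSum_mul_tmul (AlgHom.id k H) (Bialgebra.comulAlgHom k H)
    (fun μ η => (twistLeft G lam μ η).1) (fun μ η => (twistRight G lam μ η).1)
    (u := idem α) (idem_mem_weightSpace α)
    (groupTwist_mul_idem_mem_weightSpace hG lam β γ)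
  rw [← groupTwist] at l r
  rw [l, r]
  simp only [groupTwist, weightSum_mul_idem_tmul_idem, hcomul, AlgHom.id_apply,
    Algebra.TensorProduct.tmul_mul_tmul, Algebra.TensorProduct.assoc_tmul, hval, n1, n2, n3]

lemma isDynamicalTwist_groupTwist [Module.Finite k H]
    (hG : ∀ lam μ, conjChar (G lam μ) (f lam * (f μ)⁻¹) = μ * lam⁻¹) :
    IsDynamicalTwist (groupTwist G) where
  isUnit lam := (weightUnit _ _ (twist_injective hG lam)).isUnit
  comm := groupTwist_comm hG
  cocycle := groupTwist_cocycle hG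
  counit_left lam := lid_rTensor_counit_weightSum _ _ fun η => by simp [twistRight]
  counit_right lam := rid_lTensor_counit_weightSum _ _ fun μ => by simp [twistLeft]

lemma isAssociatedTwist_groupTwist [Module.Finite k H]
    (hG : ∀ lam μ, conjChar (G lam μ) (f lam * (f μ)⁻¹) = μ * lam⁻¹)
    (h : ∀ lam μ, Conjugates (G lam μ).1 (f lam) (f μ) (lam * μ⁻¹)) :
    IsAssociatedTwist (groupAlgebraStabIsos (f := f) (g := fun lam μ => (G lam μ).1) h)
      (groupTwist G) := by
  -- The coefficients are chosen so that $g(\lambda,\kappa)^{-1}$, acting diagonally in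
  -- $\Psi(\lambda,I(\lambda)(x\otimes y))$, leaves $g(\lambda,\nu)^{-1}x\otimes
  -- g(\nu,\kappa)^{-1}y$.
  refine ⟨fun lam => weightUnit _ _ (exchange_injective hG lam), ?_, fun lam => ?_⟩
  · intro X Y _ _ _ _ _ _ ρX ρY lam ν κ x y hx hy
    have e : outerRep ρX ρY (weightUnit _ _ (exchange_injective hG lam)) (x ⊗ₜ y) =
        ρX (exchangeLeft G lam (lam⁻¹ * ν) (ν⁻¹ * κ)).1.val x ⊗ₜ
          ρY (exchangeRight G lam (lam⁻¹ * ν) (ν⁻¹ * κ)).1.val y :=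
      outerRep_weightSum_tmul ρX ρY _ _ hx hy
    have hmem : outerRep ρX ρY (weightUnit _ _ (exchange_injective hG lam)) (x ⊗ₜ y) ∈
        weightSpace (tensorRep ρX ρY) (lam⁻¹ * κ) := by
      have hc := conjChar_exchange_mul hG lam (lam⁻¹ * ν) (ν⁻¹ * κ)
      rw [mul_assoc lam⁻¹, mul_inv_cancel_left] at hc
      rw [e, ← hc]
      exact tmul_mem_weightSpace (rep_val_mem_weightSpace ρX _ hx)
        (rep_val_mem_weightSpace ρY _ hy)
    refine ⟨hmem, fun F F' v => ?_⟩
    rw [groupAlgebraStabIsos_psi, groupAlgebraStabIsos_psi, groupAlgebraStabIsos_psi, e]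
    have hT : ∀ (n : GroupLike k H) (p : X) (q : Y),
        tensorRep ρX ρY n.val (p ⊗ₜ q) = ρX n.val p ⊗ₜ ρY n.val q := fun n p q => by
      simp only [tensorRep, outerRep, AlgHom.comp_apply, Bialgebra.comulAlgHom_apply,
        n.isGroupLikeElem_val.comul_eq_tmul_self]
      rfl
    have hL : ∀ (m n : GroupLike k H) (p : X), ρX m.val (ρX n.val p) = ρX (m * n).val p :=
      fun m n p => by rw [GroupLike.val_mul, map_mul]; rfl
    have hR : ∀ (m n : GroupLike k H) (q : Y), ρY m.val (ρY n.val q) = ρY (m * n).val q :=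
      fun m n q => by rw [GroupLike.val_mul, map_mul]; rfl
    have m1 : (G lam κ).1⁻¹ * (exchangeLeft G lam (lam⁻¹ * ν) (ν⁻¹ * κ)).1 = (G lam ν).1⁻¹ := by
      simp [exchangeLeft]
    have m2 : (G lam κ).1⁻¹ * (exchangeRight G lam (lam⁻¹ * ν) (ν⁻¹ * κ)).1 = (G ν κ).1⁻¹ := by
      simp [exchangeRight]
    rw [hT, hL, hR, m1, m2, TensorProduct.dualDistrib_apply]
    ring
  · refine Eq.trans ?_ (map_antipodeInv_comm_weightSumInv
      (fun μ η => (exchangeLeft G lam μ η).1) (fun μ η => (exchangeRight G lam μ η).1)).symm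
    -- The flip and the inversion of characters turn right exchange coefficients into left twist
    -- coefficients, and conversely.
    have a1 : ∀ μ η, exchangeRight G lam η⁻¹ μ⁻¹ = twistLeft G lam μ η := fun μ η => by
      simp only [exchangeRight, twistLeft, mul_right_comm lam μ⁻¹]
    have a2 : ∀ μ η, exchangeLeft G lam η⁻¹ μ⁻¹ = twistRight G lam μ η := fun μ η => by
      simp only [exchangeLeft, twistRight, mul_right_comm lam μ⁻¹]
    simp only [a1, a2]
    rfl

end GroupTwist

end DynTwist

/-! ### The main theorem. -/

theorem mainTheorem9 {k : Type*} {H : Type w} [Field k] [IsAlgClosed k] [CharZero k]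
    [Ring H] [HopfAlgebra k H] [Module.Finite k H]
    (A : Subgroup (GroupLike k H)) [Fintype A] [IsMulCommutative A]
    (f : Equiv.Perm (DynTwist.Chars k A))
    (g : DynTwist.Chars k A → DynTwist.Chars k A → GroupLike k H)
    (hg : ∀ lam μ : DynTwist.Chars k A,
      g lam μ ∈ Subgroup.normalizer (A : Set (GroupLike k H)))
    (hfg : ∀ (lam μ : DynTwist.Chars k A) (a : A),
      (f lam * (f μ)⁻¹) a = (μ * lam⁻¹) (A.normalizerMonoidHom ⟨g lam μ, hg lam μ⟩ a))
    (J : DynTwist.Chars k A → H ⊗[k] H)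
    (hJ : ∀ lam, J lam = ∑ μ : DynTwist.Chars k A, ∑ η : DynTwist.Chars k A,
      ((g lam (lam * μ⁻¹ * η⁻¹)).val * (g (lam * η⁻¹) (lam * μ⁻¹ * η⁻¹))⁻¹.val *
          DynTwist.idem μ) ⊗ₜ[k]
        ((g lam (lam * μ⁻¹ * η⁻¹)).val * (g lam (lam * η⁻¹))⁻¹.val * DynTwist.idem η)) :
    DynTwist.IsDynamicalDatum (DynTwist.groupAlgebraComodule A)
        (fun lam => DynTwist.charMod (f lam)) ∧
      DynTwist.IsDynamicalTwist J ∧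
      ∃ ω : DynTwist.StabIsos (DynTwist.groupAlgebraComodule A)
          (fun lam => DynTwist.charMod (f lam)),
        (∀ (X : Type w) [AddCommGroup X] [Module k X] [Module.Finite k X]
          (ρX : H →ₐ[k] Module.End k X) (lam ν : DynTwist.Chars k A) (x : X)
          (hx : x ∈ DynTwist.weightSpace ρX (lam⁻¹ * ν)) (F : Module.Dual k X) (c : k),
          ω.psi lam ν ρX x hx F c = c * F (ρX (g lam ν)⁻¹.val x)) ∧
        DynTwist.IsAssociatedTwist ω J := by
  let G : DynTwist.Chars k A → DynTwist.Chars k A →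
      Subgroup.normalizer (A : Set (GroupLike k H)) := fun lam μ => ⟨g lam μ, hg lam μ⟩
  -- `conjChar` precomposes with conjugation by the inverse of $g$, which undoes the conjugation in
  -- `hfg`.
  have hG : ∀ lam μ, DynTwist.conjChar (G lam μ) (f lam * (f μ)⁻¹) = μ * lam⁻¹ := by
    intro lam μ
    ext a
    rw [DynTwist.conjChar_apply, hfg, ← MulAut.mul_apply, ← map_mul]
    simp [G]
  have h : ∀ lam μ, DynTwist.Conjugates (g lam μ) (f lam) (f μ) (lam * μ⁻¹) := by
    refine fun lam μ => ⟨hg lam μ, fun a b hb => ?_⟩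
    have hb' : A.normalizerMonoidHom ⟨g lam μ, hg lam μ⟩ a = b := Subtype.ext hb.symm
    have h1 := hfg lam μ a
    rw [hb'] at h1
    -- The stabilizers involve $\lambda\mu^{-1}$ whereas `hfg` is stated with $\mu\lambda^{-1}$.
    have h2 : (lam * μ⁻¹) b = ((μ * lam⁻¹) b)⁻¹ := by simp
    rw [h2, ← h1]
    simp
  have hJG : J = DynTwist.groupTwist G := funext hJ
  subst hJG
  exact ⟨DynTwist.isDynamicalDatum_groupAlgebra h, DynTwist.isDynamicalTwist_groupTwist hG,
    DynTwist.groupAlgebraStabIsos h, fun X _ _ _ ρX lam ν x hx F c =>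
      DynTwist.groupAlgebraStabIsos_psi h ρX lam ν x hx F c,
    DynTwist.isAssociatedTwist_groupTwist hG h⟩
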